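/- Let $V$ be a finite set of random variables, each with values in a standard Borel space, and let $P$ be a joint probability distribution of these variables. Graphs. A mixed graph on $V$ consists of a set of directed edges $x\to y$ and a set of bi-directed edges $x\leftrightarrow y$ between distinct vertices (several edges may join the same two vertices). A path is a sequence of distinct vertices together with a sequence of edges joining consecutive vertices. A vertex $x$ is an ancestor of $y$, and $y$ a descendant of $x$, if $x=y$ or there is a directed path from $x$ to $y$. A semi-Markovian causal model (SMCM, or acyclic directed mixed graph) over $V$ is a mixed graph on $V$ in which no two distinct vertices are ancestors of each other. A non-endpoint vertex of a path is a collider on the path if both edges of the path at that vertex have an arrowhead there, and a non-collider otherwise. A path is m-connecting given $Z\subseteq V$ if no non-collider on it is in $Z$ and every collider on it has a descendant in $Z$. For pairwise disjoint $X,Y,Z\subseteq V$, $X$ and $Y$ are m-separated by $Z$ in $G$, written $X\perp_G Y\mid Z$, if no path between a vertex in $X$ and a vertex in $Y$ is m-connecting given $Z$. Distinct vertices $x,y$ are virtually adjacent in $G$ if there is a path between them on which every non-endpoint vertex is a collider and an ancestor of $x$ or of $y$. Assumptions relating an SMCM $G$ over $V$ and $P$. - Markov: for all pairwise disjoint $X,Y,Z\subseteq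 V$, if $X\perp_G Y\mid Z$ then $X$ and $Y$ are independent conditional on $Z$ under $P$. - Faithfulness: for all pairwise disjoint $X,Y,Z\subseteq V$, if $X$ and $Y$ are independent conditional on $Z$ under $P$, then $X\perp_G Y\mid Z$. - V-adjacency-faithfulness: for all distinct $x,y\in V$ that are virtually adjacent in $G$ and all $Z\subseteq V\setminus\{x,y\}$, $x$ and $y$ are not independent conditional on $Z$ under $P$. - V-adjacency-minimality: no SMCM over $V$ with fewer virtually adjacent (unordered) pairs than $G$ satisfies Markov with $P$. - NoI-minimality: no SMCM over $V$ that entails more conditional independence statements than $G$ satisfies Markov with $P$, where the number of conditional independence statements entailed by $G$ is the number of triples $(X,Y,Z)$ of pairwise disjoint subsets of $V$ with $X\perp_G Y\mid Z$. Theorem. Let AS be any one of V-adjacency-faithfulness, V-adjacency-minimality and NoI-minimality. Then AS is a conservative weakening of Faithfulness, given Markov, in the following sense. (a) For all $V$, $P$ and every SMCM $G$ over $V$ that satisfies Markov with $P$: if $G$ satisfies Faithfulness with $P$, then $G$ satisfies AS with $P$. The converse fails: there are $V$, $P$ and an SMCM $G$ over $V$ that satisfies Markov and AS, but not Faithfulness,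 with $P$. (b) For all $V$ and $P$: if some SMCM over $V$ satisfies both Markov and Faithfulness with $P$, then every SMCM $G$ over $V$ that satisfies Markov with $P$ satisfies Faithfulness with $P$ if and only if it satisfies AS with $P$. -/

import Mathlib

open MeasureTheory

universe u v

/-- A mixed graph on the vertex set `V`: a set of directed edges and a set of bi-directed edges,
with no edge between a vertex and itself.  Several edges (of different kinds or directions) may
join the same two vertices. -/
structure MixedGraph (V : Type u) where
  /-- `dir x y` : there is a directed edge `x → y`. -/
  dir : V → V → Prop
  /-- `bi x y` : there is a bi-directed edge `x ↔ y`. -/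
  bi : V → V → Prop
  dir_irrefl : ∀ x, ¬ dir x x
  bi_irrefl : ∀ x, ¬ bi x x
  bi_symm : ∀ x y, bi x y → bi y x

/-- The way in which an edge is traversed from `x` to `y`:
forward `x → y`, backward `x ← y`, or bi-directed `x ↔ y`. -/
inductive EdgeKind where
  | fwd
  | bwd
  | bidir

/-- The edge has an arrowhead at the vertex from which it is traversed. -/
def EdgeKind.HeadAtStart : EdgeKind → Prop
  | .fwd => False
  | .bwd => True
  | .bidir => True

/-- The edge has an arrowhead at the vertex towards which it is traversed. -/
def EdgeKind.HeadAtEnd : EdgeKind → Prop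
  | .fwd => True
  | .bwd => False
  | .bidir => True

namespace MixedGraph

variable {V : Type u}

/-- `x` is an ancestor of `y` (and `y` a descendant of `x`): `x = y`, or one can go from `x` to `y`
along directed edges. -/
def IsAncestor (G : MixedGraph V) (x y : V) : Prop := Relation.ReflTransGen G.dir x y

/-- The graph has an edge of kind `e` from `x` to `y`. -/
def HasEdge (G : MixedGraph V) : EdgeKind → V → V → Prop
  | .fwd, x, y => G.dir x y
  | .bwd, x, y => G.dir y x
  | .bidir, x, y => G.bi x y

/-- A sequence of vertices together with a sequence of edges joining consecutive ones. -/
inductive Walk (G : MixedGraph V) : V → V → Type u where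
  | nil (x : V) : Walk G x x
  | cons {x y z : V} (e : EdgeKind) (h : G.HasEdge e x y) (p : Walk G y z) : Walk G x z

/-- The list of all vertices of the walk, in order. -/
def Walk.support {G : MixedGraph V} : {x y : V} → G.Walk x y → List V
  | _, _, .nil x => [x]
  | x, _, .cons _ _ p => x :: p.support

/-- The list of the non-endpoint positions of the walk: each non-endpoint vertex with the edge
by which it is entered and the edge by which it is left. -/
def Walk.interior {G : MixedGraph V} : {x y : V} → G.Walk x y → List (V × EdgeKind × EdgeKind)
  | _, _, .nil _ => []
  | _, _, .cons _ _ (.nil _) => []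
  | _, _, .cons (y := m) e _ (.cons e' h' p) => (m, e, e') :: (Walk.cons e' h' p).interior

/-- A path is a walk whose vertices are distinct. -/
def Walk.IsPath {G : MixedGraph V} {x y : V} (p : G.Walk x y) : Prop := p.support.Nodup

/-- A non-endpoint vertex is a collider if both of its edges on the path have an arrowhead at it. -/
def IsCollider (t : V × EdgeKind × EdgeKind) : Prop := t.2.1.HeadAtEnd ∧ t.2.2.HeadAtStart

/-- `p` is m-connecting given `Z`: no non-collider on `p` is in `Z`, and every collider on `p`
has a descendant in `Z`. -/
def Walk.MConnecting {G : MixedGraph V} {x y : V} (p : G.Walk x y) (Z : Set V) : Prop :=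
  ∀ t ∈ p.interior,
    (¬ IsCollider t → t.1 ∉ Z) ∧ (IsCollider t → ∃ d ∈ Z, G.IsAncestor t.1 d)

/-- Every non-endpoint vertex of `p` is a collider on `p` and an ancestor of an endpoint of `p`. -/
def Walk.IsInducing {G : MixedGraph V} {x y : V} (p : G.Walk x y) : Prop :=
  ∀ t ∈ p.interior, IsCollider t ∧ (G.IsAncestor t.1 x ∨ G.IsAncestor t.1 y)

/-- The sets `X` and `Y` are m-separated by `Z` (used for pairwise disjoint sets only): no path
between a vertex in `X` and a vertex in `Y` is m-connecting given `Z`. -/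
def MSep (G : MixedGraph V) (X Y Z : Set V) : Prop :=
  ∀ x ∈ X, ∀ y ∈ Y, ¬ ∃ p : G.Walk x y, p.IsPath ∧ p.MConnecting Z

/-- Two distinct vertices are virtually adjacent if there is an inducing path between them. -/
def VirtuallyAdjacent (G : MixedGraph V) (x y : V) : Prop :=
  x ≠ y ∧ ∃ p : G.Walk x y, p.IsPath ∧ p.IsInducing

/-- The number of virtual adjacencies, i.e. of unordered pairs of virtually adjacent vertices. -/
noncomputable def numVirtualAdjacencies (G : MixedGraph V) : ℕ :=
  {s : Sym2 V | ∃ x y, s = s(x, y) ∧ G.VirtuallyAdjacent x y}.ncard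

end MixedGraph

/-- `X`, `Y`, `Z` are pairwise disjoint. -/
def PairwiseDisjoint₃ {V : Type u} (X Y Z : Set V) : Prop :=
  Disjoint X Y ∧ Disjoint X Z ∧ Disjoint Y Z

/-- The number of conditional independence statements entailed by the graph, i.e. of triples of
pairwise disjoint sets such that the third m-separates the first two. -/
noncomputable def MixedGraph.numIndependencies {V : Type u} (G : MixedGraph V) : ℕ :=
  {t : Set V × Set V × Set V |
    PairwiseDisjoint₃ t.1 t.2.1 t.2.2 ∧ G.MSep t.1 t.2.1 t.2.2}.ncard

/-- A semi-Markovian causal model (acyclic directed mixed graph): a mixed graph in which no two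
distinct vertices are ancestors of each other. -/
structure SMCM (V : Type u) extends MixedGraph V where
  acyclic : ∀ x y, toMixedGraph.IsAncestor x y → toMixedGraph.IsAncestor y x → x = y

section Assumptions

variable {V : Type u} [Finite V] {S : V → Type v} [∀ i, MeasurableSpace (S i)]
  [∀ i, StandardBorelSpace (S i)]

/-- Under the joint distribution `P` of the random variables indexed by `V`, the variables in `X`
and the variables in `Y` are independent conditional on the variables in `Z`. -/
def CondIndepVars (P : ProbabilityMeasure (∀ i, S i)) (X Y Z : Set V) : Prop :=
  ProbabilityTheory.CondIndepFun
    (MeasurableSpace.comap (fun (ω : ∀ i, S i) (i : Z) => ω i) MeasurableSpace.pi)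
    (Measurable.comap_le (by fun_prop))
    (fun (ω : ∀ i, S i) (i : X) => ω i)
    (fun (ω : ∀ i, S i) (i : Y) => ω i)
    (P : Measure (∀ i, S i))

/-- The causal Markov assumption. -/
def Markov (G : SMCM V) (P : ProbabilityMeasure (∀ i, S i)) : Prop :=
  ∀ X Y Z : Set V, PairwiseDisjoint₃ X Y Z → G.MSep X Y Z → CondIndepVars P X Y Z

/-- The causal Faithfulness assumption. -/
def Faithful (G : SMCM V) (P : ProbabilityMeasure (∀ i, S i)) : Prop :=
  ∀ X Y Z : Set V, PairwiseDisjoint₃ X Y Z → CondIndepVars P X Y Z → G.MSep X Y Z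

/-- V-adjacency-faithfulness: virtually adjacent variables are dependent conditional on every set
of other variables. -/
def VAdjFaithful (G : SMCM V) (P : ProbabilityMeasure (∀ i, S i)) : Prop :=
  ∀ x y : V, x ≠ y → G.VirtuallyAdjacent x y →
    ∀ Z : Set V, x ∉ Z → y ∉ Z → ¬ CondIndepVars P {x} {y} Z

/-- V-adjacency-minimality: no SMCM with fewer virtual adjacencies is Markov to `P`. -/
def VAdjMinimal (G : SMCM V) (P : ProbabilityMeasure (∀ i, S i)) : Prop :=
  ¬ ∃ G' : SMCM V, G'.numVirtualAdjacencies < G.numVirtualAdjacencies ∧ Markov G' P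

/-- NoI-minimality: no SMCM entailing more conditional independence statements is Markov
to `P`. -/
def NoIMinimal (G : SMCM V) (P : ProbabilityMeasure (∀ i, S i)) : Prop :=
  ¬ ∃ G' : SMCM V, G.numIndependencies < G'.numIndependencies ∧ Markov G' P

end Assumptions

/-- An assumption relating an SMCM over a finite set `V` of random variables (with values in
standard Borel spaces) to a joint probability distribution of these variables. -/
abbrev CausalAssumption : Type (max (u + 1) (v + 1)) :=
  ∀ (V : Type u) [Finite V] (S : V → Type v) [∀ i, MeasurableSpace (S i)]
    [∀ i, StandardBorelSpace (S i)], SMCM V → ProbabilityMeasure (∀ i, S i) → Prop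

/-- Given the causal Markov assumption, `AS` is a conservative weakening of Faithfulness:
it is entailed by Faithfulness, does not entail Faithfulness, and, for every distribution to which
some SMCM is Markov and faithful, it is equivalent to Faithfulness. -/
structure IsConservativeWeakening (AS : CausalAssumption.{u, v}) : Prop where
  entailed : ∀ (V : Type u) [Finite V] (S : V → Type v) [∀ i, MeasurableSpace (S i)]
    [∀ i, StandardBorelSpace (S i)] (P : ProbabilityMeasure (∀ i, S i)) (G : SMCM V),
    Markov G P → Faithful G P → AS V S G P
  not_entails : ¬ ∀ (V : Type u) [Finite V] (S : V → Type v) [∀ i, MeasurableSpace (S i)]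
    [∀ i, StandardBorelSpace (S i)] (P : ProbabilityMeasure (∀ i, S i)) (G : SMCM V),
    Markov G P → AS V S G P → Faithful G P
  conservative : ∀ (V : Type u) [Finite V] (S : V → Type v) [∀ i, MeasurableSpace (S i)]
    [∀ i, StandardBorelSpace (S i)] (P : ProbabilityMeasure (∀ i, S i)),
    (∃ G₀ : SMCM V, Markov G₀ P ∧ Faithful G₀ P) →
      ∀ G : SMCM V, Markov G P → (Faithful G P ↔ AS V S G P)

/-! Let `G` be Markov to `P`, and `G₀` Markov and faithful. Every m-separation of `G` is an
independence of `P`, hence an m-separation of `G₀`. Distinct vertices are virtually adjacent exactly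
when no set m-separates them, so the virtual adjacencies of `G₀` are among those of `G`.
NoI-minimality turns the first inclusion into an equality by counting; each V-adjacency assumption
does so for the second. Part (b) thus comes down to `connLE_of_adjAgree`, with `G₁ = G` and `G₂ =
G₀`: if the m-separations of `G₁` hold in `G₂` and the virtual adjacencies coincide, the
m-separations coincide.

This is proved by induction over marginals: vertices outside `W` count as latent, and sinks are
removed from `W`. It suffices to treat connections given all other members of a subset `B` of `W`
that is ancestral in `G₂` (`connLE_of_ancestral`). If `B` is proper, a sink of `G₂` outside `B` is
removed; that the adjacencies then still agree is the delicate point (`adjAgree_diff_sink_right`).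
If `B = W`, the connection is a collider path. On a shortest one the colliders remain colliders in
`G₂` (`MinimalColliderPath.colliders`), so it connects there too.

For the failure of the converse take the chain `n0 → n1 → n2` with independent coins at the ends and
their pair in the middle. Neighbours are dependent given any set of other variables, which yields
all three assumptions, but the ends are independent although m-connected. -/

namespace MixedGraph

/-! ### Treks: walks that record only the arrowheads at their ends. -/

variable {V : Type u}

/-- The ancestors of the members of `S`. -/
def anc (G : MixedGraph V) (S : Set V) : Set V := {v | ∃ s ∈ S, G.IsAncestor v s}

theorem subset_anc (G : MixedGraph V) (S : Set V) : S ⊆ G.anc S :=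
  fun v hv => ⟨v, hv, Relation.ReflTransGen.refl⟩

theorem anc_mono (G : MixedGraph V) {S T : Set V} (h : S ⊆ T) : G.anc S ⊆ G.anc T :=
  fun _ ⟨s, hs, hvs⟩ => ⟨s, h hs, hvs⟩

theorem anc_lower {G : MixedGraph V} {S : Set V} {u w : V} (hw : w ∈ G.anc S)
    (h : G.IsAncestor u w) : u ∈ G.anc S :=
  let ⟨s, hs, hws⟩ := hw
  ⟨s, hs, Relation.ReflTransGen.trans h hws⟩

theorem anc_subset_anc {G : MixedGraph V} {S T : Set V} (h : S ⊆ G.anc T) :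
    G.anc S ⊆ G.anc T :=
  fun _ ⟨_, hs, hvs⟩ => anc_lower (h hs) hvs

/-- There is a walk from `x` to `y` with at least one edge, all of whose inner non-colliders lie in
`N` and all of whose inner colliders lie in `C`; the flags record whether there is an arrowhead at
`x` and at `y`. -/
inductive Trek (G : MixedGraph V) (N C : Set V) : V → Bool → Bool → V → Prop
  | fwd {x y : V} : G.dir x y → Trek G N C x false true y
  | bwd {x y : V} : G.dir y x → Trek G N C x true false y
  | bidir {x y : V} : G.bi x y → Trek G N C x true true y
  | collider {x v y : V} {a b : Bool} :
      Trek G N C x a true v → Trek G N C v true b y → v ∈ C → Trek G N C x a b y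
  | noncollider {x v y : V} {a b c d : Bool} : Trek G N C x a b v → Trek G N C v c d y →
      (b = false ∨ c = false) → v ∈ N → Trek G N C x a d y

namespace Trek

variable {G : MixedGraph V} {N C N' C' : Set V} {x y v : V} {a b c d : Bool}

theorem mono (h : G.Trek N C x a b y) (hN : N ⊆ N') (hC : C ⊆ C') : G.Trek N' C' x a b y := by
  induction h with
  | fwd h => exact .fwd h
  | bwd h => exact .bwd h
  | bidir h => exact .bidir h
  | collider _ _ h ih₁ ih₂ => exact .collider ih₁ ih₂ (hC h)
  | noncollider _ _ hf h ih₁ ih₂ => exact .noncollider ih₁ ih₂ hf (hN h)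

theorem symm (h : G.Trek N C x a b y) : G.Trek N C y b a x := by
  induction h with
  | fwd h => exact .bwd h
  | bwd h => exact .fwd h
  | bidir h => exact .bidir (G.bi_symm _ _ h)
  | collider _ _ h ih₁ ih₂ => exact .collider ih₂ ih₁ h
  | noncollider _ _ hf h ih₁ ih₂ => exact .noncollider ih₂ ih₁ hf.symm h

theorem join (h₁ : G.Trek N C x a b v) (h₂ : G.Trek N C v c d y)
    (hC : b = true → c = true → v ∈ C) (hN : b = false ∨ c = false → v ∈ N) :
    G.Trek N C x a d y := by
  cases b <;> cases c <;> simp at hC hN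
  · exact .noncollider h₁ h₂ (.inl rfl) hN
  · exact .noncollider h₁ h₂ (.inl rfl) hN
  · exact .noncollider h₁ h₂ (.inr rfl) hN
  · exact .collider h₁ h₂ hC

/-- Follow directed edges down from `v`. -/
theorem directed (h : Relation.TransGen G.dir v x) (hN : ∀ u, u ≠ v → u ≠ x →
      Relation.TransGen G.dir v u → Relation.TransGen G.dir u x → u ∈ N)
    (hac : ∀ u, ¬ Relation.TransGen G.dir u u) :
    G.Trek N C v false true x := by
  induction h with
  | single h => exact .fwd h
  | @tail p q hp hpq ih =>
    refine .noncollider (ih fun u h₁ h₂ h₃ h₄ => hN u h₁ ?_ h₃ (h₄.tail hpq)) (.fwd hpq)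
      (.inr rfl) (hN p ?_ ?_ hp (.single hpq))
    · rintro rfl
      exact hac _ (h₄.tail hpq)
    · rintro rfl
      exact hac _ hp
    · rintro rfl
      exact hac _ (.single hpq)

/-- Cut the walk at its first non-collider outside `P`. -/
theorem exists_first (h : G.Trek N C x a b y) (P : Set V) :
    G.Trek (N ∩ P) C x a b y ∨ ∃ v ∈ N \ P, ∃ b', G.Trek (N ∩ P) C x a b' v := by
  induction h with
  | fwd h => exact .inl (.fwd h)
  | bwd h => exact .inl (.bwd h)
  | bidir h => exact .inl (.bidir h)
  | collider _ _ h ih₁ ih₂ =>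
    rcases ih₁ with h₁ | h₁
    · rcases ih₂ with h₂ | ⟨w, hw, b', h₂⟩
      · exact .inl (.collider h₁ h₂ h)
      · exact .inr ⟨w, hw, b', .collider h₁ h₂ h⟩
    · exact .inr h₁
  | @noncollider x v y a b c d _ _ hf h ih₁ ih₂ =>
    rcases ih₁ with h₁ | h₁
    · by_cases hv : v ∈ P
      · rcases ih₂ with h₂ | ⟨w, hw, b', h₂⟩
        · exact .inl (.noncollider h₁ h₂ hf ⟨h, hv⟩)
        · exact .inr ⟨w, hw, b', .noncollider h₁ h₂ hf ⟨h, hv⟩⟩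
      · exact .inr ⟨v, ⟨h, hv⟩, b, h₁⟩
    · exact .inr h₁

/-- Cut at the last visit to `x`; the right half is therefore inspected before the meeting point and
the left half. -/
theorem avoid_aux {u : V} (h : G.Trek N C u a b y) (x : V) :
    G.Trek (N \ {x}) (C \ {x}) u a b y ∨ ∃ a', G.Trek (N \ {x}) (C \ {x}) x a' b y := by
  induction h with
  | fwd h => exact .inl (.fwd h)
  | bwd h => exact .inl (.bwd h)
  | bidir h => exact .inl (.bidir h)
  | @collider _ v _ _ _ _ _ h ih₁ ih₂ =>
    rcases ih₂ with h₂ | h₂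
    · by_cases hv : v = x
      · subst hv; exact .inr ⟨_, h₂⟩
      · rcases ih₁ with h₁ | ⟨a', h₁⟩
        · exact .inl (.collider h₁ h₂ ⟨h, hv⟩)
        · exact .inr ⟨a', .collider h₁ h₂ ⟨h, hv⟩⟩
    · exact .inr h₂
  | @noncollider _ v _ _ _ _ _ _ _ hf h ih₁ ih₂ =>
    rcases ih₂ with h₂ | h₂
    · by_cases hv : v = x
      · subst hv; exact .inr ⟨_, h₂⟩
      · rcases ih₁ with h₁ | ⟨a', h₁⟩
        · exact .inl (.noncollider h₁ h₂ hf ⟨h, hv⟩)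
        · exact .inr ⟨a', .noncollider h₁ h₂ hf ⟨h, hv⟩⟩
    · exact .inr h₂

/-- A walk can be cut so that it does not revisit its start. -/
theorem avoid_left (h : G.Trek N C x a b y) :
    ∃ a', G.Trek (N \ {x}) (C \ {x}) x a' b y := by
  rcases h.avoid_aux x with h | h
  · exact ⟨a, h⟩
  · exact h

theorem avoid_ends (h : G.Trek N C x a b y) :
    ∃ a' b', G.Trek ((N \ {x}) \ {y}) ((C \ {x}) \ {y}) x a' b' y := by
  obtain ⟨a', h₁⟩ := h.avoid_left
  obtain ⟨b', h₂⟩ := h₁.symm.avoid_left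
  exact ⟨a', b', h₂.symm⟩

end Trek

end MixedGraph

/-! ### Treks in acyclic graphs. -/

namespace SMCM

open MixedGraph

variable {V : Type u} {G : SMCM V} {N C N' C' : Set V} {x y v : V} {a b c d : Bool}

theorem not_transGen_self (G : SMCM V) (u : V) : ¬ Relation.TransGen G.dir u u := by
  intro h
  obtain ⟨w, h₁, h₂⟩ := Relation.TransGen.head'_iff.1 h
  have := G.acyclic u w (.single h₁) h₂
  subst this
  exact G.dir_irrefl _ h₁

theorem transGen_of_isAncestor {u w : V} (h : G.IsAncestor u w) (hne : u ≠ w) :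
    Relation.TransGen G.dir u w := by
  rcases Relation.reflTransGen_iff_eq_or_transGen.1 h with h | h
  · exact absurd h.symm hne
  · exact h

/-- From a tail at one end the walk runs along directed edges until it meets a collider or the other
end. Acyclicity excludes that two such runs point at each other. -/
theorem trek_tail (h : G.Trek N C x a b y) :
    (b = false → ∃ c ∈ insert x C, Relation.TransGen G.dir y c) ∧
    (a = false → ∃ c ∈ insert y C, Relation.TransGen G.dir x c) := by
  have key : ∀ {x v y : V}, (∃ c ∈ insert x C, Relation.TransGen G.dir v c) →
      (∃ c ∈ insert v C, Relation.TransGen G.dir y c) →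
      ∃ c ∈ insert x C, Relation.TransGen G.dir y c := by
    rintro x v y h₁ ⟨c, hc, h₂⟩
    rcases hc with rfl | hc
    · obtain ⟨c', hc', h₁⟩ := h₁
      exact ⟨c', hc', h₂.trans h₁⟩
    · exact ⟨c, .inr hc, h₂⟩
  have key₂ : ∀ {x v y : V}, (∃ c ∈ insert y C, Relation.TransGen G.dir v c) →
      (∃ c ∈ insert v C, Relation.TransGen G.dir y c) →
      ∃ c ∈ insert x C, Relation.TransGen G.dir y c := by
    rintro x v y ⟨c', hc', h₁⟩ ⟨c, hc, h₂⟩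
    rcases hc with rfl | hc
    · rcases hc' with rfl | hc'
      · exact absurd (h₁.trans h₂) (G.not_transGen_self _)
      · exact ⟨c', .inr hc', h₂.trans h₁⟩
    · exact ⟨c, .inr hc, h₂⟩
  induction h with
  | fwd h => exact ⟨by simp, fun _ => ⟨_, Set.mem_insert _ _, .single h⟩⟩
  | bwd h => exact ⟨fun _ => ⟨_, Set.mem_insert _ _, .single h⟩, by simp⟩
  | bidir h => simp
  | @collider x v y a b _ _ hv ih₁ ih₂ =>
    refine ⟨fun hb => ?_, fun ha => ?_⟩
    · obtain ⟨c, hc, h⟩ := ih₂.1 hb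
      exact ⟨c, .inr (hc.elim (fun e => e ▸ hv) id), h⟩
    · obtain ⟨c, hc, h⟩ := ih₁.2 ha
      exact ⟨c, .inr (hc.elim (fun e => e ▸ hv) id), h⟩
  | @noncollider x v y a b c d _ _ hf hv ih₁ ih₂ =>
    refine ⟨fun hd => ?_, fun ha => ?_⟩
    · rcases hf with hf | hf
      · exact key (ih₁.1 hf) (ih₂.1 hd)
      · exact key₂ (ih₂.2 hf) (ih₂.1 hd)
    · rcases hf with hf | hf
      · exact key₂ (ih₁.1 hf) (ih₁.2 ha)
      · exact key (ih₂.2 hf) (ih₁.2 ha)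

/-- All inner vertices of a walk lie in every ancestral set containing its ends and its
colliders. -/
theorem trek_inter_lower {D : Set V} (hD : ∀ u w, w ∈ D → G.IsAncestor u w → u ∈ D)
    (hC : C ⊆ D) (h : G.Trek N C x a b y) (hx : x ∈ D) (hy : y ∈ D) :
    G.Trek (N ∩ D) C x a b y := by
  induction h with
  | fwd h => exact .fwd h
  | bwd h => exact .bwd h
  | bidir h => exact .bidir h
  | collider _ _ h ih₁ ih₂ => exact .collider (ih₁ hx (hC h)) (ih₂ (hC h) hy) h
  | @noncollider x v y a b c d h₁ h₂ hf h ih₁ ih₂ =>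
    have hv : v ∈ D := by
      rcases hf with hf | hf
      · obtain ⟨c, hc, h'⟩ := (trek_tail h₁).1 hf
        refine hD _ c ?_ h'.to_reflTransGen
        rcases hc with rfl | hc
        exacts [hx, hC hc]
      · obtain ⟨c, hc, h'⟩ := (trek_tail h₂).2 hf
        refine hD _ c ?_ h'.to_reflTransGen
        rcases hc with rfl | hc
        exacts [hy, hC hc]
    exact .noncollider (ih₁ hx hv) (ih₂ hv hy) hf ⟨h, hv⟩

theorem trek_directed {Z : Set V} (h : G.IsAncestor v x) (hne : v ≠ x) (hv : v ∉ G.anc Z) :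
    G.Trek Zᶜ C v false true x :=
  Trek.directed (transGen_of_isAncestor h hne) (fun _ _ _ h₃ _ hu =>
    hv ⟨_, hu, h₃.to_reflTransGen⟩) G.not_transGen_self

/-- Take the last collider whose descendants reach `x` but not `S`. Its directed path to `x` avoids
`Z`, so this path reversed can replace everything before the collider, which becomes a non-collider.
-/
theorem trek_bypass_left {u w : V} {Z S : Set V} (hZS : Z ⊆ S)
    (h : G.Trek Zᶜ (G.anc (insert x S)) u a b w) :
    G.Trek Zᶜ (G.anc S) u a b w ∨ ∃ a', G.Trek Zᶜ (G.anc S) x a' b w := by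
  induction h with
  | fwd h => exact .inl (.fwd h)
  | bwd h => exact .inl (.bwd h)
  | bidir h => exact .inl (.bidir h)
  | @collider u v w _ _ _ _ hv ih₁ ih₂ =>
    rcases ih₂ with h₂ | h₂
    · by_cases hvS : v ∈ G.anc S
      · rcases ih₁ with h₁ | ⟨a', h₁⟩
        · exact .inl (.collider h₁ h₂ hvS)
        · exact .inr ⟨a', .collider h₁ h₂ hvS⟩
      · have hvZ : v ∉ G.anc Z := fun h => hvS (G.anc_mono hZS h)
        obtain ⟨s, hs, hvs⟩ := hv
        rcases hs with rfl | hs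
        · by_cases hvx : v = s
          · subst hvx; exact .inr ⟨_, h₂⟩
          · exact .inr ⟨true, .noncollider (trek_directed hvs hvx hvZ).symm h₂ (.inl rfl)
              fun h => hvZ (G.subset_anc _ h)⟩
        · exact absurd ⟨s, hs, hvs⟩ hvS
    · exact .inr h₂
  | noncollider _ _ hf h ih₁ ih₂ =>
    rcases ih₂ with h₂ | h₂
    · rcases ih₁ with h₁ | ⟨a', h₁⟩
      · exact .inl (.noncollider h₁ h₂ hf h)
      · exact .inr ⟨a', .noncollider h₁ h₂ hf h⟩
    · exact .inr h₂

end SMCM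

/-! ### Connection and adjacency in marginals. -/

namespace MixedGraph

variable {V : Type u}

/-- `x` and `y` are joined by a walk that is m-connecting given `Z`. -/
def Conn (G : MixedGraph V) (Z : Set V) (x y : V) : Prop :=
  ∃ a b, G.Trek Zᶜ (G.anc Z) x a b y

/-- `x` and `y` are virtually adjacent in the marginal of the graph on `W`. -/
def Adj (G : MixedGraph V) (W : Set V) (x y : V) : Prop :=
  x ≠ y ∧ ∃ a b, G.Trek Wᶜ (G.anc {x, y}) x a b y

theorem Conn.symm {G : MixedGraph V} {Z : Set V} {x y : V} (h : G.Conn Z x y) : G.Conn Z y x :=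
  let ⟨a, b, h⟩ := h
  ⟨b, a, h.symm⟩

theorem Adj.symm {G : MixedGraph V} {Z : Set V} {x y : V} (h : G.Adj Z x y) : G.Adj Z y x :=
  let ⟨hne, a, b, h⟩ := h
  ⟨hne.symm, b, a, Set.pair_comm x y ▸ h.symm⟩

end MixedGraph

namespace SMCM

open MixedGraph

variable {V : Type u} {G : SMCM V} {N C W Z : Set V} {x y v u : V} {a b c d : Bool}

/-- Colliders may also be ancestors of the ends of the walk. -/
theorem conn_of_trek (h : G.Trek Zᶜ (G.anc (insert x (insert y Z))) x a b y) :
    G.Conn Z x y := by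
  have h₁ : ∃ a', G.Trek Zᶜ (G.anc (insert y Z)) x a' b y := by
    rcases trek_bypass_left (Set.subset_insert y Z) h with h | h
    exacts [⟨a, h⟩, h]
  obtain ⟨a', h₁⟩ := h₁
  rcases trek_bypass_left (Set.Subset.refl Z) h₁.symm with h | ⟨b', h⟩
  · exact ⟨_, _, h.symm⟩
  · exact ⟨_, _, h.symm⟩

theorem Adj.conn (h : G.Adj W x y) (hZ : Z ⊆ W) : G.Conn Z x y := by
  obtain ⟨-, a, b, h⟩ := h
  refine conn_of_trek (h.mono (Set.compl_subset_compl.2 hZ) (G.anc_mono ?_))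
  rintro w (rfl | rfl) <;> simp

/-- A connection given all other observed members of an ancestral set. -/
theorem trek_of_conn {B : Set V} (hB : ∀ v ∈ W, v ∈ G.anc B → v ∈ B) (hx : x ∈ B)
    (hy : y ∈ B) (hZB : Z ⊆ B) (h : G.Conn Z x y) (hBZ : ∀ v ∈ B, v ≠ x → v ≠ y → v ∈ Z) :
    ∃ a b, G.Trek Wᶜ (G.anc Z) x a b y := by
  obtain ⟨a, b, h⟩ := h
  obtain ⟨a', b', h⟩ := h.avoid_ends
  refine ⟨a', b', ?_⟩
  have h' := trek_inter_lower (D := G.anc B) (fun _ _ h₁ h₂ => anc_lower h₁ h₂)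
    ((Set.sdiff_subset.trans Set.sdiff_subset).trans (G.anc_mono hZB)) h
    (G.subset_anc _ hx) (G.subset_anc _ hy)
  refine h'.mono ?_ (Set.sdiff_subset.trans Set.sdiff_subset)
  rintro v ⟨⟨⟨hvZ, hvx⟩, hvy⟩, hvB⟩ hvW
  exact hvZ (hBZ v (hB v hvW hvB) hvx hvy)

/-- The observed ancestors of the two ends form the canonical separator: a walk connecting given
them stays among the ancestors, so its non-colliders are latent and it witnesses adjacency. -/
theorem not_conn_of_not_adj (hne : x ≠ y) (hx : x ∈ W) (hy : y ∈ W) (h : ¬ G.Adj W x y) :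
    ¬ G.Conn ((G.anc {x, y} ∩ W) \ {x, y}) x y := by
  intro hc
  obtain ⟨a, b, ht⟩ := trek_of_conn (W := W) (B := G.anc {x, y} ∩ W)
    (fun v hv h => ⟨anc_subset_anc Set.inter_subset_left h, hv⟩)
    ⟨G.subset_anc _ (by simp), hx⟩ ⟨G.subset_anc _ (by simp), hy⟩ Set.sdiff_subset hc
    (fun v hv h₁ h₂ => ⟨hv, by simp [h₁, h₂]⟩)
  exact h ⟨hne, a, b, ht.mono subset_rfl
    (anc_subset_anc (Set.sdiff_subset.trans Set.inter_subset_left))⟩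

/-- A connecting walk visits only ancestors of its ends and of `Z`, so it never meets `u`. -/
theorem conn_insert (hu : u ∉ G.anc (insert x (insert y Z))) (h : G.Conn Z x y) :
    G.Conn (insert u Z) x y := by
  obtain ⟨a, b, h⟩ := h
  have h' := trek_inter_lower (D := G.anc (insert x (insert y Z)))
    (fun _ _ h₁ h₂ => anc_lower h₁ h₂) (G.anc_mono (by simp [Set.subset_def]; tauto)) h
    (G.subset_anc _ (by simp)) (G.subset_anc _ (by simp))
  refine ⟨a, b, h'.mono ?_ (G.anc_mono (Set.subset_insert _ _))⟩
  rintro v ⟨hvZ, hvB⟩ (rfl | hv)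
  exacts [hu hvB, hvZ hv]

theorem conn_or_conn (h : G.Conn Z x y) : G.Conn (insert u Z) x y ∨ G.Conn Z x u := by
  obtain ⟨a, b, h⟩ := h
  rcases h.exists_first {u}ᶜ with h | ⟨v, hv, b', h⟩
  · refine .inl ⟨a, b, h.mono ?_ (G.anc_mono (Set.subset_insert _ _))⟩
    rintro v ⟨hvZ, hvu⟩ (rfl | hv)
    exacts [hvu rfl, hvZ hv]
  · have : v = u := by simpa using hv.2
    subst this
    exact .inr ⟨a, b', h.mono Set.inter_subset_left subset_rfl⟩

/-- By `trek_tail` both walks must reach `u` with an arrowhead, since `u` is no ancestor of their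
other ends or of `Z`. So `u` is a collider, opened by conditioning on it. -/
theorem conn_of_conn_of_conn (hu : u ∉ G.anc (insert x (insert y Z))) (h₁ : G.Conn Z x u)
    (h₂ : G.Conn Z u y) : G.Conn (insert u Z) x y := by
  have key : ∀ {x a b}, u ∉ G.anc (insert x Z) → G.Trek Zᶜ (G.anc Z) x a b u →
      ∃ a', G.Trek (insert u Z)ᶜ (G.anc (insert u Z)) x a' true u := by
    intro x a b hu h
    obtain ⟨b', h⟩ := h.symm.avoid_left
    refine ⟨a, ?_⟩
    cases b' with
    | false =>
      obtain ⟨c, hc, h'⟩ := (trek_tail h).2 rfl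
      refine absurd ?_ hu
      rcases hc with rfl | ⟨hc, -⟩
      · exact ⟨c, by simp, h'.to_reflTransGen⟩
      · exact anc_lower (G.anc_mono (Set.subset_insert _ _) hc) h'.to_reflTransGen
    | true =>
      refine h.symm.mono ?_ (Set.sdiff_subset.trans (G.anc_mono (Set.subset_insert _ _)))
      rintro v ⟨hvZ, hvu⟩ (rfl | hv)
      exacts [hvu rfl, hvZ hv]
  obtain ⟨a, b, h₁⟩ := h₁
  obtain ⟨c, d, h₂⟩ := h₂
  obtain ⟨a', h₁⟩ := key (fun h => hu (G.anc_mono (by simp [Set.subset_def]; tauto) h)) h₁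
  obtain ⟨d', h₂⟩ := key (fun h => hu (G.anc_mono (by simp [Set.subset_def]; tauto) h)) h₂.symm
  exact ⟨a', d', .collider h₁ h₂.symm (G.subset_anc _ (by simp))⟩

end SMCM

/-! ### From walks to paths. -/

/-- Boolean version of `EdgeKind.HeadAtStart`. -/
def EdgeKind.startFlag : EdgeKind → Bool
  | .fwd => false
  | .bwd => true
  | .bidir => true

/-- Boolean version of `EdgeKind.HeadAtEnd`. -/
def EdgeKind.endFlag : EdgeKind → Bool
  | .fwd => true
  | .bwd => false
  | .bidir => true

theorem EdgeKind.startFlag_eq_true {e : EdgeKind} : e.startFlag = true ↔ e.HeadAtStart := by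
  cases e <;> simp [startFlag, HeadAtStart]

theorem EdgeKind.endFlag_eq_true {e : EdgeKind} : e.endFlag = true ↔ e.HeadAtEnd := by
  cases e <;> simp [endFlag, HeadAtEnd]

namespace MixedGraph

variable {V : Type u}

theorem Trek.edge {G : MixedGraph V} {N C : Set V} {x y : V} {e : EdgeKind}
    (h : G.HasEdge e x y) : G.Trek N C x e.startFlag e.endFlag y := by
  cases e
  exacts [.fwd h, .bwd h, .bidir h]

theorem HasEdge.ne {G : MixedGraph V} {x y : V} {e : EdgeKind} (h : G.HasEdge e x y) : x ≠ y := by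
  rintro rfl
  cases e
  exacts [G.dir_irrefl _ h, G.dir_irrefl _ h, G.bi_irrefl _ h]

/-- `v` may be passed when entering with flag `b` and leaving with flag `c`. -/
def Passes (N C : Set V) (b : Bool) (v : V) (c : Bool) : Prop :=
  (b = true → c = true → v ∈ C) ∧ (b = false ∨ c = false → v ∈ N)

/-- Leaving `v` with flag `c'` instead of `c` is harmless. -/
def Exchanges (N C : Set V) (v : V) (c c' : Bool) : Prop :=
  (c = true → c' = false → v ∈ N) ∧ (c = false → c' = true → v ∈ C)

theorem Passes.exchange {N C : Set V} {b c c' : Bool} {v : V} (h : Passes N C b v c)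
    (h' : Exchanges N C v c c') : Passes N C b v c' := by
  obtain ⟨h₁, h₂⟩ := h
  obtain ⟨h₃, h₄⟩ := h'
  constructor <;> cases b <;> cases c <;> cases c' <;> simp_all

/-- A path ending in `y`, with its first flag and its list of vertices. -/
inductive Route (G : MixedGraph V) (N C : Set V) (y : V) : V → Option Bool → List V → Prop
  | nil : Route G N C y y none [y]
  | cons {x z : V} {o : Option Bool} {l : List V} (e : EdgeKind) : G.HasEdge e x z →
      Route G N C y z o l → x ∉ l → (∀ c, o = some c → Passes N C e.endFlag z c) →
      Route G N C y x (some e.startFlag) (x :: l)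

/-- The discarded initial piece is kept as a trek: its arrowhead at `x` is needed when a loop
through `x` is cut out. -/
theorem Route.suffix {G : MixedGraph V} {N C : Set V} {x y z : V} {o : Option Bool} {l : List V}
    (h : G.Route N C y z o l) (hx : x ∈ l) : x = z ∨ ∃ o' l' a b, o = some a ∧
      G.Route N C y x o' l' ∧ G.Trek N C z a b x ∧ ∀ c, o' = some c → Passes N C b x c := by
  induction h with
  | nil => simpa using hx
  | @cons x' z o l e he hr hl hp ih =>
    rcases List.mem_cons.1 hx with rfl | hx
    · exact .inl rfl
    · refine .inr ?_
      rcases ih hx with rfl | ⟨o', l', a, b, rfl, hr', ht, hp'⟩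
      · exact ⟨o, l, _, _, rfl, hr, .edge he, hp⟩
      · have := hp a rfl
        exact ⟨o', l', _, b, rfl, hr', (Trek.edge he).join ht this.1 this.2, hp'⟩

/-- The flag at the start of the first edge of a walk. -/
def Walk.firstFlag {G : MixedGraph V} : {x y : V} → G.Walk x y → Option Bool
  | _, _, .nil _ => none
  | _, _, .cons e _ _ => some e.startFlag

theorem Route.exists_walk {G : MixedGraph V} {N C : Set V} {x y : V} {o : Option Bool}
    {l : List V} (h : G.Route N C y x o l) : ∃ p : G.Walk x y, p.support = l ∧ p.IsPath ∧
      p.firstFlag = o ∧ ∀ t ∈ p.interior, (¬ IsCollider t → t.1 ∈ N) ∧ (IsCollider t → t.1 ∈ C) := by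
  induction h with
  | nil => exact ⟨.nil y, by simp [Walk.support, Walk.IsPath, Walk.firstFlag, Walk.interior]⟩
  | @cons x z o l e he hr hl hp ih =>
    obtain ⟨p, rfl, h₂, rfl, h₄⟩ := ih
    refine ⟨.cons e he p, rfl, List.nodup_cons.2 ⟨hl, h₂⟩, rfl, ?_⟩
    cases p with
    | nil => simp [Walk.interior]
    | cons e' he' q =>
      intro t ht
      rcases List.mem_cons.1 ht with rfl | ht
      · have := hp _ rfl
        simp only [Passes, ← Bool.not_eq_true, EdgeKind.startFlag_eq_true,
          EdgeKind.endFlag_eq_true] at this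
        simp only [IsCollider]
        tauto
      · exact h₄ t ht

theorem Walk.exists_trek {G : MixedGraph V} {N C : Set V} {x y : V} (p : G.Walk x y)
    {a : Bool} (ha : p.firstFlag = some a)
    (h : ∀ t ∈ p.interior, (¬ IsCollider t → t.1 ∈ N) ∧ (IsCollider t → t.1 ∈ C)) :
    ∃ b, G.Trek N C x a b y := by
  induction p generalizing a with
  | nil => simp [Walk.firstFlag] at ha
  | @cons x z y e he p ih =>
    simp only [Walk.firstFlag, Option.some.injEq] at ha
    subst ha
    cases p with
    | nil => exact ⟨_, .edge he⟩
    | cons e' he' q =>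
      obtain ⟨b, hb⟩ := ih rfl fun t ht => h t (List.mem_cons_of_mem _ ht)
      have := h _ (List.mem_cons_self)
      simp only [IsCollider] at this
      refine ⟨b, (Trek.edge he).join hb ?_ ?_⟩
      · simp only [EdgeKind.startFlag_eq_true, EdgeKind.endFlag_eq_true]
        tauto
      · simp only [← Bool.not_eq_true, EdgeKind.startFlag_eq_true, EdgeKind.endFlag_eq_true]
        tauto

theorem Walk.firstFlag_isSome {G : MixedGraph V} {x y : V} (p : G.Walk x y) (hne : x ≠ y) :
    ∃ a, p.firstFlag = some a := by
  cases p with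
  | nil => exact absurd rfl hne
  | cons e _ _ => exact ⟨_, rfl⟩

end MixedGraph

namespace SMCM

open MixedGraph

variable {V : Type u} {G : SMCM V} {N C W Z : Set V} {x y v u : V} {a b c d : Bool}

/-- Edges are prepended one at a time, and a loop is cut out as soon as a vertex recurs. The cut may
alter the flag with which that vertex is left; `Exchanges` says that this does no harm. -/
theorem exists_route_of_trek (hC : ∀ u w, w ∈ C → G.IsAncestor u w → u ∈ C)
    (h : G.Trek N C u a b v) {o : Option Bool} {l : List V} (hr : G.Route N C y v o l)
    (hp : ∀ c, o = some c → Passes N C b v c) :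
    ∃ o' l', G.Route N C y u o' l' ∧ ∀ c, o' = some c → Exchanges N C u a c := by
  have edge : ∀ (e : EdgeKind) {x z : V} {o l}, G.HasEdge e x z → G.Route N C y z o l →
      (∀ c, o = some c → Passes N C e.endFlag z c) →
      ∃ o' l', G.Route N C y x o' l' ∧ ∀ c, o' = some c → Exchanges N C x e.startFlag c := by
    intro e x z o l he hr hp
    by_cases hx : x ∈ l
    · rcases hr.suffix hx with rfl | ⟨o', l', a, b, rfl, hr', ht, hp'⟩
      · exact absurd rfl he.ne
      · refine ⟨o', l', hr', fun c hc => ⟨fun _ hcf => (hp' c hc).2 (.inr hcf), fun he' hct => ?_⟩⟩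
        cases b with
        | true => exact (hp' c hc).1 rfl hct
        | false =>
          have hpa := hp a rfl
          -- The loop returns to `x` by a tail, hence `x` is a proper ancestor of itself, which is
          -- absurd, or of a member of `C`.
          obtain ⟨w, hw, h⟩ := (trek_tail ((Trek.edge he).join ht hpa.1 hpa.2)).1 rfl
          rcases hw with rfl | hw
          · exact absurd h (G.not_transGen_self _)
          · exact hC _ _ hw h.to_reflTransGen
    · refine ⟨_, _, .cons e he hr hx hp, fun c hc => ?_⟩
      simp only [Option.some.injEq] at hc
      subst hc
      constructor <;> intro h₁ h₂ <;> simp [h₁] at h₂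
  induction h generalizing o l with
  | fwd h => exact edge .fwd h hr hp
  | bwd h => exact edge .bwd h hr hp
  | bidir h => exact edge .bidir h hr hp
  | collider _ _ hv ih₁ ih₂ =>
    obtain ⟨o', l', hr', hx⟩ := ih₂ hr hp
    exact ih₁ hr' fun c hc => Passes.exchange ⟨fun _ _ => hv, by simp⟩ (hx c hc)
  | noncollider _ _ hf hv ih₁ ih₂ =>
    obtain ⟨o', l', hr', hx⟩ := ih₂ hr hp
    refine ih₁ hr' fun c hc => Passes.exchange ⟨fun h₁ h₂ => ?_, fun _ => hv⟩ (hx c hc)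
    simp [h₁, h₂] at hf

theorem exists_path_iff (hC : ∀ u w, w ∈ C → G.IsAncestor u w → u ∈ C) (hne : x ≠ y) :
    (∃ p : G.Walk x y, p.IsPath ∧
      ∀ t ∈ p.interior, (¬ IsCollider t → t.1 ∈ N) ∧ (IsCollider t → t.1 ∈ C)) ↔
    ∃ a b, G.Trek N C x a b y := by
  constructor
  · rintro ⟨p, -, h⟩
    obtain ⟨a, ha⟩ := p.firstFlag_isSome hne
    exact ⟨a, p.exists_trek ha h⟩
  · rintro ⟨a, b, h⟩
    obtain ⟨o, l, hr, -⟩ := exists_route_of_trek hC h .nil (by simp)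
    obtain ⟨p, -, h₁, -, h₂⟩ := hr.exists_walk
    exact ⟨p, h₁, h₂⟩

theorem exists_mConnecting_iff (hne : x ≠ y) :
    (∃ p : G.Walk x y, p.IsPath ∧ p.MConnecting Z) ↔ G.Conn Z x y :=
  exists_path_iff (N := Zᶜ) (C := G.anc Z) (fun _ _ h₁ h₂ => anc_lower h₁ h₂) hne

theorem virtuallyAdjacent_iff : G.VirtuallyAdjacent x y ↔ G.Adj Set.univ x y := by
  refine and_congr_right fun hne => ?_
  rw [← exists_path_iff (fun _ _ h₁ h₂ => anc_lower h₁ h₂) hne]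
  refine exists_congr fun p => and_congr_right fun _ => forall₂_congr fun t _ => ?_
  simp only [anc, Set.mem_insert_iff, Set.mem_singleton_iff, exists_eq_or_imp, exists_eq_left,
    Set.compl_univ, Set.mem_empty_iff_false, imp_false, not_not, Set.mem_ofPred_eq]
  tauto

theorem mSep_iff {X Y : Set V} (h : Disjoint X Y) :
    G.MSep X Y Z ↔ ∀ x ∈ X, ∀ y ∈ Y, ¬ G.Conn Z x y := by
  refine forall₂_congr fun x hx => forall₂_congr fun y hy => not_congr ?_
  exact exists_mConnecting_iff (h.ne_of_mem hx hy)

end SMCM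

/-! ### Index combinatorics of minimal collider paths. -/

/-- The combinatorics of minimal collider paths `0, …, n`: if a condition `C` can be established
at an inner vertex as soon as it is known at the other inner vertices of a suitable segment, then
it holds at all of them. -/
theorem colliders_of_segments {n : ℕ} {le adj : ℕ → ℕ → Prop} {C : ℕ → Prop}
    (trans : ∀ a b c, le a b → le b c → le a c)
    (inner : ∀ k, k + 1 < n → ¬ le (k + 1) k ∧ ¬ le (k + 1) (k + 2))
    (chord : ∀ a b, a + 2 ≤ b → b ≤ n → adj a b → (0 < a ∧ le a b) ∨ (b < n ∧ le b a))
    (inducing : ∀ a b, a + 2 ≤ b → b ≤ n → (∀ l, a < l → l < b → le l a ∨ le l b) → adj a b)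
    (core : ∀ a i b, a < i → i < b → b ≤ n → ¬ adj a b →
      (∀ l, a < l → l < b → l ≠ i → le l a ∨ le l b) →
      (∀ l, a < l → l < b → l ≠ i → C l) → C i) :
    ∀ i, 0 < i → i < n → C i := by
  have unshielded : ∀ k, k + 1 < n → ¬ adj k (k + 2) → C (k + 1) := fun k hk h =>
    core k (k + 1) (k + 2) (by omega) (by omega) (by omega) h (fun l _ _ _ => by omega)
      (fun l _ _ _ => by omega)
  -- Move the right end outwards until it is not adjacent to `k`. A chord from `k` to `c + 1` must
  -- be of the second kind, as the first would give `le c (c + 1)`; so `c + 1` is inner and again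
  -- below `k`, and the search stops at `n` at the latest.
  have rightSeg : ∀ m k c, n - c = m → k + 2 ≤ c → c < n → (∀ l, k + 1 < l → l ≤ c → le l k) →
      ∃ j, k + 2 < j ∧ j ≤ n ∧ ¬ adj k j ∧ ∀ l, k + 1 < l → l < j → le l k := by
    intro m
    induction m with
    | zero => intro k c h₁ _ h₂; omega
    | succ m ih =>
      intro k c hm hkc hcn hl
      by_cases hadj : adj k (c + 1)
      · rcases chord k (c + 1) (by omega) (by omega) hadj with ⟨-, h⟩ | ⟨h₁, h₂⟩
        · obtain ⟨c, rfl⟩ : ∃ c', c = c' + 1 := ⟨c - 1, by omega⟩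
          exact absurd (trans _ _ _ (hl (c + 1) (by omega) le_rfl) h) (inner c hcn).2
        · refine ih k (c + 1) (by omega) (by omega) h₁ fun l h₃ h₄ => ?_
          rcases Nat.lt_or_ge c l with h | h
          · rwa [show l = c + 1 by omega]
          · exact hl l h₃ h
      · exact ⟨c + 1, by omega, by omega, hadj, fun l h₁ h₂ => hl l h₁ (by omega)⟩
  have leftSeg : ∀ c k, c ≤ k → 0 < c → k + 1 < n → (∀ l, c ≤ l → l < k + 1 → le l (k + 2)) →
      ∃ j, j < k ∧ ¬ adj j (k + 2) ∧ ∀ l, j < l → l < k + 1 → le l (k + 2) := by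
    intro c
    induction c with
    | zero => intro k _ h; omega
    | succ c ih =>
      intro k hck _ hk hl
      by_cases hadj : adj c (k + 2)
      · rcases chord c (k + 2) (by omega) (by omega) hadj with ⟨h₁, h₂⟩ | ⟨-, h⟩
        · refine ih k (by omega) h₁ hk fun l h₃ h₄ => ?_
          rcases Nat.lt_or_ge c l with h | h
          · exact hl l h h₄
          · rwa [show l = c by omega]
        · exact absurd (trans _ _ _ (hl (c + 1) le_rfl (by omega)) h) (inner c (by omega)).1
      · exact ⟨c, by omega, hadj, fun l h₁ h₂ => hl l (by omega) h₂⟩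
  have right : ∀ m k, n - k = m → k + 2 < n → le (k + 2) k → C (k + 1) := by
    intro m
    induction m using Nat.strong_induction_on with
    | _ m ih =>
      intro k hm hk hle
      obtain ⟨j, hkj, hjn, hadj, hj⟩ := rightSeg _ k (k + 2) rfl le_rfl hk
        (fun l h₁ h₂ => by rwa [show l = k + 2 by omega])
      have between : ∀ l, k + 1 < l → l < j → C l := by
        intro l
        induction l using Nat.strong_induction_on with
        | _ l ihl =>
          intro h₁ h₂
          obtain ⟨l, rfl⟩ : ∃ l', l = l' + 1 := ⟨l - 1, by omega⟩
          by_cases hl : adj l (l + 2)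
          · rcases chord l (l + 2) le_rfl (by omega) hl with ⟨h₃, h₄⟩ | ⟨h₃, h₄⟩
            · obtain ⟨j', hj'l, hadj', hj'⟩ := leftSeg l l le_rfl h₃ (by omega)
                (fun m _ _ => by rwa [show m = l by omega])
              -- The left extension must stay to the right of `k`, where the inner induction
              -- applies. Otherwise `k + 1` lies below `l + 2`: if `l + 2 < j` it then lies below
              -- `k`, and if `l + 2 = j` the segment from `k` to `j` is inducing.
              have hkj' : k < j' := by
                by_contra hlt
                have hk1 : le (k + 1) (l + 2) := hj' (k + 1) (by omega) (by omega)
                rcases Nat.lt_or_ge (l + 2) j with h | h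
                · exact (inner k (by omega)).1 (trans _ _ _ hk1 (hj (l + 2) (by omega) h))
                · obtain rfl : j = l + 2 := by omega
                  refine hadj (inducing k (l + 2) (by omega) hjn fun m hm₁ hm₂ => ?_)
                  rcases Nat.lt_or_ge (k + 1) m with h' | h'
                  · exact .inl (hj m h' hm₂)
                  · rw [show m = k + 1 by omega]
                    exact .inr hk1
              refine core j' (l + 1) (l + 2) (by omega) (by omega) (by omega) hadj'
                (fun m _ _ _ => .inr (hj' m (by omega) (by omega))) fun m _ _ _ => ?_
              exact ihl m (by omega) (by omega) (by omega)
            · exact ih _ (by omega) l rfl h₃ h₄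
          · exact unshielded l (by omega) hl
      refine core k (k + 1) j (by omega) (by omega) hjn hadj
        (fun l _ _ _ => .inl (hj l (by omega) (by omega))) fun l _ _ _ => ?_
      exact between l (by omega) (by omega)
  intro i
  induction i using Nat.strong_induction_on with
  | _ i ih =>
    intro h₀ hi
    obtain ⟨k, rfl⟩ : ∃ k, i = k + 1 := ⟨i - 1, by omega⟩
    by_cases hadj : adj k (k + 2)
    · rcases chord k (k + 2) le_rfl (by omega) hadj with ⟨h₁, h₂⟩ | ⟨h₁, h₂⟩
      · obtain ⟨j, hjk, hadj', hj⟩ := leftSeg k k le_rfl h₁ hi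
          (fun m _ _ => by rwa [show m = k by omega])
        refine core j (k + 1) (k + 2) (by omega) (by omega) (by omega) hadj'
          (fun m _ _ _ => .inr (hj m (by omega) (by omega))) fun m _ _ _ => ?_
        exact ih m (by omega) (by omega) (by omega)
      · exact right _ k rfl h₁ h₂
    · exact unshielded k hi hadj

/-! ### Existence and composition of minimal collider paths. -/

namespace SMCM

open MixedGraph

variable {V : Type u} {G : SMCM V} {N C B W Z : Set V} {x y v u : V} {a b c d : Bool}

theorem trek_down {B : Set V} (hB : ∀ v ∈ W, v ∈ G.anc B → v ∈ B) (hv : v ∈ G.anc B) :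
    v ∈ B ∨ ∃ z ∈ B, G.Trek Wᶜ C v false true z := by
  obtain ⟨s, hs, h⟩ := hv
  induction h using Relation.ReflTransGen.head_induction_on with
  | refl => exact .inl hs
  | @head v w hvw hws ih =>
    right
    rcases ih with hw | ⟨z, hz, ht⟩
    · exact ⟨w, hw, .fwd hvw⟩
    · by_cases hwW : w ∈ W
      · exact ⟨w, hB w hwW ⟨s, hs, hws⟩, .fwd hvw⟩
      · exact ⟨z, hz, .noncollider (.fwd hvw) ht (.inr rfl) hwW⟩

/-- At a latent collider outside `B`, descend to a member of `B` and come back: the latent vertex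
turns into a non-collider and the member of `B` is the new collider. -/
theorem trek_colliders_mem {B : Set V} (hB : ∀ v ∈ W, v ∈ G.anc B → v ∈ B)
    (h : G.Trek Wᶜ (G.anc B) x a b y) : G.Trek Wᶜ B x a b y := by
  induction h with
  | fwd h => exact .fwd h
  | bwd h => exact .bwd h
  | bidir h => exact .bidir h
  | @collider _ v _ _ _ _ _ hv ih₁ ih₂ =>
    by_cases hvW : v ∈ W
    · exact .collider ih₁ ih₂ (hB v hvW hv)
    · rcases trek_down (C := B) hB hv with hv | ⟨z, hz, ht⟩
      · exact .collider ih₁ ih₂ hv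
      · exact .collider (.noncollider ih₁ ht (.inr rfl) hvW)
          (.noncollider ht.symm ih₂ (.inl rfl) hvW) hz
  | noncollider _ _ hf hv ih₁ ih₂ => exact .noncollider ih₁ ih₂ hf hv

/-- A concatenation of walks without colliders which meet at colliders in `B`. -/
inductive Links (G : SMCM V) (N B : Set V) (x : V) (a : Bool) : Bool → V → Prop
  | single {b : Bool} {y : V} : G.Trek N ∅ x a b y → Links G N B x a b y
  | snoc {b : Bool} {v y : V} : Links G N B x a true v → v ∈ B → G.Trek N ∅ v true b y →
      Links G N B x a b y

theorem Links.trans (h₁ : G.Links N B x a true v) (hv : v ∈ B) (h₂ : G.Links N B v true b y) :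
    G.Links N B x a b y := by
  induction h₂ with
  | single h => exact .snoc h₁ hv h
  | snoc _ hw h ih => exact .snoc ih hw h

theorem Links.glue (h₁ : G.Links N B x a b v) (h₂ : G.Links N B v c d y)
    (hf : b = false ∨ c = false) (hv : v ∈ N) : G.Links N B x a d y := by
  induction h₂ with
  | single h =>
    cases h₁ with
    | single h' => exact .single (.noncollider h' h hf hv)
    | snoc h' hw h'' => exact .snoc h' hw (.noncollider h'' h hf hv)
  | snoc _ hw h ih => exact .snoc ih hw h

theorem links_of_trek (h : G.Trek N B x a b y) : G.Links N B x a b y := by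
  induction h with
  | fwd h => exact .single (.fwd h)
  | bwd h => exact .single (.bwd h)
  | bidir h => exact .single (.bidir h)
  | collider _ _ hv ih₁ ih₂ => exact ih₁.trans hv ih₂
  | noncollider _ _ hf hv ih₁ ih₂ => exact ih₁.glue ih₂ hf hv

/-- An inducing walk with prescribed arrowheads. -/
def Link (G : SMCM V) (W : Set V) (p r : Prop) (x y : V) : Prop :=
  ∃ a b, G.Trek Wᶜ (G.anc {x, y}) x a b y ∧ (p → a = true) ∧ (r → b = true)

/-- A sequence of inducing walks which meet at colliders. -/
def Chain (G : SMCM V) (W : Set V) (n : ℕ) (q : ℕ → V) : Prop :=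
  ∀ i < n, G.Link W (0 < i) (i + 1 < n) (q i) (q (i + 1))

theorem Links.exists_chain (h : G.Links Wᶜ B x a b y) (hx : x ∈ B) :
    ∃ (n : ℕ) (q : ℕ → V), 0 < n ∧ q 0 = x ∧ q n = y ∧ (∀ i < n, q i ∈ B) ∧
      ∀ i < n, G.Link W (0 < i) (i + 1 < n ∨ b = true) (q i) (q (i + 1)) := by
  induction h with
  | @single b y h =>
    refine ⟨1, fun i => if i = 0 then x else y, by simp, by simp, by simp, by simpa, ?_⟩
    intro i hi
    obtain rfl : i = 0 := by omega
    exact ⟨a, b, h.mono subset_rfl (Set.empty_subset _), by simp, by simp⟩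
  | @snoc b v y _ hv h ih =>
    obtain ⟨n, q, hn, h0, hqn, hB, hl⟩ := ih
    refine ⟨n + 1, fun i => if i ≤ n then q i else y, by simp, by simpa, by simp, ?_, ?_⟩
    · intro i hi
      simp only [show i ≤ n by omega, if_true]
      rcases Nat.lt_or_ge i n with h | h
      · exact hB i h
      · rwa [show i = n by omega, hqn]
    · intro i hi
      rcases Nat.lt_or_ge i n with h' | h'
      · simp only [show i ≤ n by omega, show i + 1 ≤ n by omega, if_true]
        obtain ⟨a', b', ht, h₁, h₂⟩ := hl i h'
        exact ⟨a', b', ht, h₁, fun _ => h₂ (by simp)⟩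
      · obtain rfl : i = n := by omega
        simp only [le_refl, if_true, hqn, show ¬ i + 1 ≤ i by omega, if_false]
        exact ⟨true, b, h.mono subset_rfl (Set.empty_subset _), by simp, by simp⟩

/-- The `j - i - 1` points strictly between `i` and `j` are dropped. -/
theorem Chain.shortcut {n i j : ℕ} {q : ℕ → V} (h : G.Chain W n q) (hij : i < j) (hj : j ≤ n)
    (hl : G.Link W (0 < i) (j < n) (q i) (q j)) :
    G.Chain W (n - (j - i - 1)) (fun l => if l ≤ i then q l else q (l + (j - i - 1))) := by
  intro l hln
  rcases lt_trichotomy l i with hli | rfl | hli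
  · simp only [show l ≤ i by omega, show l + 1 ≤ i by omega, if_true]
    obtain ⟨a, b, ht, h₁, h₂⟩ := h l (by omega)
    exact ⟨a, b, ht, h₁, fun _ => h₂ (by omega)⟩
  · simp only [le_refl, if_true, show ¬ l + 1 ≤ l by omega, if_false,
      show l + 1 + (j - l - 1) = j by omega]
    obtain ⟨a, b, ht, h₁, h₂⟩ := hl
    exact ⟨a, b, ht, h₁, fun _ => h₂ (by omega)⟩
  · simp only [show ¬ l ≤ i by omega, show ¬ l + 1 ≤ i by omega, if_false]
    obtain ⟨a, b, ht, h₁, h₂⟩ := h (l + (j - i - 1)) (by omega)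
    rw [show l + 1 + (j - i - 1) = l + (j - i - 1) + 1 by omega]
    exact ⟨a, b, ht, fun _ => h₁ (by omega), fun _ => h₂ (by omega)⟩

theorem Link.merge {p r : Prop} (h₁ : G.Link W p True x v) (h₂ : G.Link W True r v y)
    (hv : G.IsAncestor v x ∨ G.IsAncestor v y) : G.Link W p r x y := by
  obtain ⟨a, b, h₁, ha, hb⟩ := h₁
  obtain ⟨c, d, h₂, hc, hd⟩ := h₂
  obtain rfl := hb trivial
  obtain rfl := hc trivial
  have hv : v ∈ G.anc {x, y} := by
    rcases hv with h | h
    exacts [⟨x, by simp, h⟩, ⟨y, by simp, h⟩]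
  refine ⟨a, d, .collider (h₁.mono subset_rfl ?_) (h₂.mono subset_rfl ?_) hv, ha, hd⟩
  · refine anc_subset_anc ?_
    rintro w (rfl | rfl)
    exacts [G.subset_anc _ (by simp), hv]
  · refine anc_subset_anc ?_
    rintro w (rfl | rfl)
    exacts [hv, G.subset_anc _ (by simp)]

/-- By `trek_tail`, a tail at an end makes it an ancestor of the other end, since it cannot be a
proper ancestor of itself. -/
theorem Adj.link (h : G.Adj W x y) : G.Link W (¬ G.IsAncestor x y) (¬ G.IsAncestor y x) x y := by
  obtain ⟨-, a, b, h⟩ := h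
  refine ⟨a, b, h, fun hn => ?_, fun hn => ?_⟩
  · by_contra ha
    obtain ⟨c, hc, hxc⟩ := (trek_tail h).2 (by simpa using ha)
    rcases hc with rfl | ⟨c', hc', hcc⟩
    · exact hn hxc.to_reflTransGen
    · rcases hc' with rfl | rfl
      · exact G.not_transGen_self _ (hxc.trans_left hcc)
      · exact hn (hxc.trans_left hcc).to_reflTransGen
  · by_contra hb
    obtain ⟨c, hc, hyc⟩ := (trek_tail h).1 (by simpa using hb)
    rcases hc with rfl | ⟨c', hc', hcc⟩
    · exact hn hyc.to_reflTransGen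
    · rcases hc' with rfl | rfl
      · exact hn (hyc.trans_left hcc).to_reflTransGen
      · exact G.not_transGen_self _ (hyc.trans_left hcc)

/-- A collider path, in the marginal on `W`, that cannot be shortened. -/
structure MinimalColliderPath (G : SMCM V) (W : Set V) (n : ℕ) (q : ℕ → V) : Prop where
  pos : 0 < n
  mem : ∀ i ≤ n, q i ∈ W
  ne : ∀ i j, i < j → j ≤ n → q i ≠ q j
  adj : ∀ i < n, G.Adj W (q i) (q (i + 1))
  inner : ∀ i, i + 1 < n → ¬ G.IsAncestor (q (i + 1)) (q i) ∧ ¬ G.IsAncestor (q (i + 1)) (q (i + 2))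
  chord : ∀ i j, i + 2 ≤ j → j ≤ n → G.Adj W (q i) (q j) →
    (0 < i ∧ G.IsAncestor (q i) (q j)) ∨ (j < n ∧ G.IsAncestor (q j) (q i))

/-- A chain of least length works, since every failure of a defining property yields a shortcut:
`Link.merge` absorbs an inner vertex that is an ancestor of a neighbour, and a chord with the
required arrowheads (`Adj.link`) replaces a segment. -/
theorem exists_minimalColliderPath (hB : ∀ v ∈ W, v ∈ G.anc B → v ∈ B) (hBW : B ⊆ W)
    (hx : x ∈ B) (hy : y ∈ B) (hne : x ≠ y) (h : G.Trek Wᶜ (G.anc B) x a b y) :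
    ∃ n q, G.MinimalColliderPath W n q ∧ q 0 = x ∧ q n = y ∧ ∀ i ≤ n, q i ∈ B := by
  classical
  have hex : ∃ n, ∃ q : ℕ → V, q 0 = x ∧ q n = y ∧ (∀ i ≤ n, q i ∈ B) ∧ G.Chain W n q := by
    obtain ⟨n, q, -, h0, hn, hqB, hl⟩ := (links_of_trek (trek_colliders_mem hB h)).exists_chain hx
    refine ⟨n, q, h0, hn, fun i hi => ?_, fun i hi => ?_⟩
    · rcases hi.lt_or_eq with hi | rfl
      exacts [hqB i hi, hn ▸ hy]
    · obtain ⟨a', b', ht, h₁, h₂⟩ := hl i hi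
      exact ⟨a', b', ht, h₁, fun h => h₂ (.inl h)⟩
  obtain ⟨q, h0, hn, hqB, hch⟩ := Nat.find_spec hex
  have hmin : ∀ m, m < Nat.find hex → ∀ q : ℕ → V, q 0 = x → q m = y → (∀ i ≤ m, q i ∈ B) →
      ¬ G.Chain W m q := fun m hm q h₁ h₂ h₃ h₄ => Nat.find_min hex hm ⟨q, h₁, h₂, h₃, h₄⟩
  generalize Nat.find hex = n at *
  have hpos : 0 < n := by
    rcases Nat.eq_zero_or_pos n with rfl | h
    · exact absurd (h0.symm.trans hn) hne
    · exact h
  have short : ∀ i j, i + 2 ≤ j → j ≤ n → ¬ G.Link W (0 < i) (j < n) (q i) (q j) := by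
    intro i j hij hj hl
    refine hmin _ ?_ _ ?_ ?_ ?_ (hch.shortcut (by omega) hj hl)
    · omega
    · simpa
    · simp only [show ¬ n - (j - i - 1) ≤ i by omega, if_false]
      rwa [show n - (j - i - 1) + (j - i - 1) = n by omega]
    · intro l hl
      split_ifs
      exacts [hqB _ (by omega), hqB _ (by omega)]
  have inner : ∀ i, i + 1 < n →
      ¬ G.IsAncestor (q (i + 1)) (q i) ∧ ¬ G.IsAncestor (q (i + 1)) (q (i + 2)) := by
    intro i hi
    rw [← not_or]
    intro h
    refine short i (i + 2) le_rfl (by omega) (Link.merge ?_ ?_ h)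
    · obtain ⟨a', b', ht, h₁, h₂⟩ := hch i (by omega)
      exact ⟨a', b', ht, h₁, fun _ => h₂ hi⟩
    · obtain ⟨a', b', ht, h₁, h₂⟩ := hch (i + 1) hi
      exact ⟨a', b', ht, fun _ => h₁ (by omega), h₂⟩
  -- For a repeated vertex, the link leaving `q j` also leaves `q i`; if `j = n` there is none, and
  -- the link entering `q i` is used instead.
  have hneq : ∀ i j, i < j → j ≤ n → q i ≠ q j := by
    intro i j hij hj he
    rcases hj.lt_or_eq with hjn | rfl
    · refine short i (j + 1) (by omega) hjn ?_
      obtain ⟨a', b', ht, h₁, h₂⟩ := hch j hjn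
      rw [he]
      exact ⟨a', b', ht, fun _ => h₁ (by omega), h₂⟩
    · obtain ⟨i, rfl⟩ : ∃ k, i = k + 1 := by
        rcases Nat.eq_zero_or_pos i with rfl | h
        · exact absurd (h0.symm.trans (he.trans hn)) hne
        · exact ⟨i - 1, by omega⟩
      refine short i j (by omega) le_rfl ?_
      obtain ⟨a', b', ht, h₁, h₂⟩ := hch i (by omega)
      rw [← he]
      exact ⟨a', b', ht, h₁, fun h => absurd h (lt_irrefl _)⟩
  refine ⟨n, q, ⟨hpos, fun i hi => hBW (hqB i hi), hneq, fun i hi => ?_, inner, ?_⟩, h0, hn, hqB⟩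
  · obtain ⟨a', b', ht, -, -⟩ := hch i hi
    exact ⟨hneq i (i + 1) (by omega) hi, a', b', ht⟩
  · intro i j hij hj hadj
    by_contra hcon
    rw [not_or, not_and, not_and] at hcon
    obtain ⟨a', b', ht, h₁, h₂⟩ := Adj.link hadj
    exact short i j hij hj ⟨a', b', ht, fun h => h₁ (hcon.1 h), fun h => h₂ (hcon.2 h)⟩

/-- Virtual adjacencies which meet at colliders compose. -/
theorem exists_segment_trek {q : ℕ → V} {i : ℕ} {D : Set V}
    (hD : ∀ u w, w ∈ D → G.IsAncestor u w → u ∈ D) :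
    ∀ {j : ℕ}, i < j → (∀ l, i ≤ l → l < j → G.Adj W (q l) (q (l + 1))) →
    (∀ l, i < l → l < j → ¬ G.IsAncestor (q l) (q (l - 1)) ∧ ¬ G.IsAncestor (q l) (q (l + 1))) →
    (∀ l, i ≤ l → l ≤ j → q l ∈ D) →
    ∃ a b, G.Trek Wᶜ D (q i) a b (q j) ∧ (¬ G.IsAncestor (q j) (q (j - 1)) → b = true) := by
  have hsub : ∀ {x y}, x ∈ D → y ∈ D → G.anc {x, y} ⊆ D := by
    rintro x y hx hy w ⟨s, rfl | rfl, hs⟩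
    exacts [hD _ _ hx hs, hD _ _ hy hs]
  intro j hij
  induction j, hij using Nat.le_induction with
  | base =>
    intro hadj _ hq
    obtain ⟨a, b, ht, h₁, h₂⟩ := Adj.link (hadj i le_rfl (by omega))
    exact ⟨a, b, ht.mono subset_rfl
      (hsub (hq i (by omega) (by omega)) (hq (i + 1) (by omega) (by omega))), h₂⟩
  | succ j hij ih =>
    intro hadj hcol hq
    obtain ⟨a, b, ht, hb⟩ := ih (fun l h₁ h₂ => hadj l h₁ (by omega))
      (fun l h₁ h₂ => hcol l h₁ (by omega)) (fun l h₁ h₂ => hq l h₁ (by omega))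
    obtain ⟨c, d, ht', hc, hd⟩ := Adj.link (hadj j (by omega) (by omega))
    obtain ⟨h₁, h₂⟩ := hcol j (by omega) (by omega)
    obtain rfl := hb h₁
    obtain rfl := hc h₂
    exact ⟨a, d, .collider ht (ht'.mono subset_rfl
      (hsub (hq j (by omega) (by omega)) (hq (j + 1) (by omega) (by omega))))
      (hq j (by omega) (by omega)), hd⟩

end SMCM

/-! ### Comparison of two graphs with the same virtual adjacencies. -/

namespace SMCM

open MixedGraph

variable {V : Type u} {G G₁ G₂ : SMCM V} {B W Z : Set V} {x y s t : V}

/-- On `W`, everything m-connected in the first graph is m-connected in the second one. -/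
def ConnLE (G₁ G₂ : SMCM V) (W : Set V) : Prop :=
  ∀ x ∈ W, ∀ y ∈ W, x ≠ y → ∀ Z ⊆ W, x ∉ Z → y ∉ Z → G₁.Conn Z x y → G₂.Conn Z x y

/-- The marginals on `W` have the same virtual adjacencies. -/
def AdjAgree (G₁ G₂ : SMCM V) (W : Set V) : Prop :=
  ∀ x ∈ W, ∀ y ∈ W, (G₁.Adj W x y ↔ G₂.Adj W x y)

theorem ConnLE.mono {W' : Set V} (h : ConnLE G₁ G₂ W) (hW : W' ⊆ W) : ConnLE G₁ G₂ W' :=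
  fun x hx y hy hne Z hZ h₁ h₂ => h x (hW hx) y (hW hy) hne Z (hZ.trans hW) h₁ h₂

/-- The colliders on a minimal collider path are colliders in every graph with the same virtual
adjacencies and fewer m-connections. -/
theorem MinimalColliderPath.colliders {n : ℕ} {q : ℕ → V} (hq : G₁.MinimalColliderPath W n q)
    (hadj : AdjAgree G₁ G₂ W) (hle : ConnLE G₂ G₁ W) : ∀ i, 0 < i → i < n →
      ¬ G₂.IsAncestor (q i) (q (i - 1)) ∧ ¬ G₂.IsAncestor (q i) (q (i + 1)) := by
  have inducing : ∀ a b, a + 2 ≤ b → b ≤ n →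
      (∀ l, a < l → l < b → G₁.IsAncestor (q l) (q a) ∨ G₁.IsAncestor (q l) (q b)) →
      G₁.Adj W (q a) (q b) := by
    intro a b hab hb hl
    have hcol : ∀ l, a < l → l < b →
        ¬ G₁.IsAncestor (q l) (q (l - 1)) ∧ ¬ G₁.IsAncestor (q l) (q (l + 1)) := by
      intro l h₁ h₂
      obtain ⟨l, rfl⟩ : ∃ k, l = k + 1 := ⟨l - 1, by omega⟩
      exact hq.inner l (by omega)
    have hD : ∀ l, a ≤ l → l ≤ b → q l ∈ G₁.anc {q a, q b} := by
      intro l h₁ h₂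
      rcases h₁.lt_or_eq with h₁ | rfl
      · rcases h₂.lt_or_eq with h₂ | rfl
        · rcases hl l h₁ h₂ with h | h
          exacts [⟨_, by simp, h⟩, ⟨_, by simp, h⟩]
        · exact G₁.subset_anc _ (by simp)
      · exact G₁.subset_anc _ (by simp)
    obtain ⟨f, g, ht, -⟩ := exists_segment_trek (fun _ _ h₁ h₂ => anc_lower h₁ h₂)
      (show a < b by omega) (fun l _ _ => hq.adj l (by omega)) hcol hD
    exact ⟨hq.ne a b (by omega) hb, f, g, ht⟩
  refine colliders_of_segments (le := fun a b => G₁.IsAncestor (q a) (q b))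
    (adj := fun a b => G₁.Adj W (q a) (q b)) (fun _ _ _ h₁ h₂ => h₁.trans h₂) hq.inner hq.chord
    inducing ?_
  intro a i b hai hib hbn hnadj hanc hcol
  by_contra hcon
  rw [← not_or, not_not] at hcon
  have hne := hq.ne a b (by omega) hbn
  have ha := hq.mem a (by omega)
  have hb := hq.mem b hbn
  -- The canonical separator in `G₁`, which also separates in `G₂`. It contains the inner vertices
  -- of the segment except `q i`, whose membership would make the segment inducing.
  set T : Set V := (G₁.anc {q a, q b} ∩ W) \ {q a, q b} with hT
  have hTW : T ⊆ W := Set.sdiff_subset.trans Set.inter_subset_right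
  have hiT : q i ∉ T := by
    rintro ⟨⟨⟨s, hs, h⟩, -⟩, -⟩
    refine hnadj (inducing a b (by omega) hbn fun l h₁ h₂ => ?_)
    by_cases hli : l = i
    · subst hli
      rcases hs with rfl | rfl
      exacts [.inl h, .inr h]
    · exact hanc l h₁ h₂ hli
  have hlT : ∀ l, a < l → l < b → l ≠ i → q l ∈ T := by
    intro l h₁ h₂ h₃
    refine ⟨⟨?_, hq.mem l (by omega)⟩, ?_⟩
    · rcases hanc l h₁ h₂ h₃ with h | h
      exacts [⟨_, by simp, h⟩, ⟨_, by simp, h⟩]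
    · rintro (h | h)
      exacts [hq.ne a l h₁ (by omega) h.symm, hq.ne l b h₂ hbn h]
  have hsep : ¬ G₂.Conn T (q a) (q b) := fun h => not_conn_of_not_adj hne ha hb hnadj
    (hle _ ha _ hb hne T hTW (by simp [hT]) (by simp [hT]) h)
  set D := G₂.anc (insert (q a) (insert (q b) T)) with hD
  have hDl : ∀ u w, w ∈ D → G₂.IsAncestor u w → u ∈ D := fun _ _ h₁ h₂ => anc_lower h₁ h₂
  have hqD' : ∀ l, a ≤ l → l ≤ b → l ≠ i → q l ∈ D := by
    intro l h₁ h₂ h₃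
    refine G₂.subset_anc _ ?_
    rcases h₁.lt_or_eq with h₁ | rfl
    · rcases h₂.lt_or_eq with h₂ | rfl
      · exact .inr (.inr (hlT l h₁ h₂ h₃))
      · simp
    · simp
  have hqD : ∀ l, a ≤ l → l ≤ b → q l ∈ D := by
    intro l h₁ h₂
    by_cases h₃ : l = i
    · subst h₃
      rcases hcon with h | h
      · exact hDl _ _ (hqD' (l - 1) (by omega) (by omega) (by omega)) h
      · exact hDl _ _ (hqD' (l + 1) (by omega) (by omega) (by omega)) h
    · exact hqD' l h₁ h₂ h₃
  have hadj₂ : ∀ l < n, G₂.Adj W (q l) (q (l + 1)) := fun l hl =>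
    (hadj _ (hq.mem l (by omega)) _ (hq.mem _ hl)).1 (hq.adj l hl)
  obtain ⟨f₁, g₁, ht₁, -⟩ := exists_segment_trek (G := G₂) (W := W) (q := q) hDl hai
    (fun l _ _ => hadj₂ l (by omega)) (fun l _ _ => hcol l (by omega) (by omega) (by omega))
    (fun l _ _ => hqD l (by omega) (by omega))
  obtain ⟨f₂, g₂, ht₂, -⟩ := exists_segment_trek (G := G₂) (W := W) (q := q) hDl hib
    (fun l _ _ => hadj₂ l (by omega)) (fun l _ _ => hcol l (by omega) (by omega) (by omega))
    (fun l _ _ => hqD l (by omega) (by omega))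
  have hN : Wᶜ ⊆ Tᶜ := Set.compl_subset_compl.2 hTW
  -- If `q i` were an ancestor of a neighbour in `G₂`, it would lie in `D` and outside `T`, so the
  -- two halves could be joined there whatever their arrowheads.
  exact hsep (conn_of_trek ((ht₁.mono hN subset_rfl).join (ht₂.mono hN subset_rfl)
    (fun _ _ => hqD i hai.le hib.le) (fun _ => hiT)))

theorem MinimalColliderPath.conn {n : ℕ} {q : ℕ → V} (hq : G₁.MinimalColliderPath W n q)
    (hadj : AdjAgree G₁ G₂ W) (hle : ConnLE G₂ G₁ W) (hZ : Z ⊆ W)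
    (hqZ : ∀ i, 0 < i → i < n → q i ∈ Z) : G₂.Conn Z (q 0) (q n) := by
  have hD : ∀ l, 0 ≤ l → l ≤ n → q l ∈ G₂.anc (insert (q 0) (insert (q n) Z)) := by
    intro l _ hl
    refine G₂.subset_anc _ ?_
    rcases Nat.eq_zero_or_pos l with rfl | h
    · simp
    · rcases hl.lt_or_eq with hl | rfl
      · exact .inr (.inr (hqZ l h hl))
      · simp
  obtain ⟨a, b, ht, -⟩ := exists_segment_trek (fun _ _ h₁ h₂ => anc_lower h₁ h₂) hq.pos
    (fun l _ hl => (hadj _ (hq.mem l (by omega)) _ (hq.mem _ hl)).1 (hq.adj l hl))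
    (hq.colliders hadj hle) hD
  exact conn_of_trek (ht.mono (Set.compl_subset_compl.2 hZ) subset_rfl)

theorem exists_sink [Finite V] (G : SMCM V) (hW : W.Nonempty) :
    ∃ s ∈ W, ∀ w ∈ W, G.IsAncestor s w → w = s := by
  let r : V → V → Prop := fun u w => Relation.TransGen G.dir w u
  have : IsTrans V r := ⟨fun _ _ _ h₁ h₂ => Relation.TransGen.trans h₂ h₁⟩
  have : Std.Irrefl r := ⟨fun u => G.not_transGen_self u⟩
  obtain ⟨s, hs, h⟩ := (Finite.wellFounded_of_trans_of_irrefl r).has_min W hW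
  refine ⟨s, hs, fun w hw hsw => ?_⟩
  by_contra hne
  exact h w hw (transGen_of_isAncestor hsw (Ne.symm hne))

/-- Passing to a smaller `W'` can only create adjacencies. A separator inside `W'` forbids a new one
in `G₁`, and also in `G₂` because it separates there too. -/
theorem adjAgree_of_separators {W' : Set V} (hW : W' ⊆ W) (hadj : AdjAgree G₁ G₂ W)
    (hle : ConnLE G₂ G₁ W) (h : ∀ a ∈ W', ∀ b ∈ W', a ≠ b → ¬ G₁.Adj W a b →
      ∃ T ⊆ W', a ∉ T ∧ b ∉ T ∧ ¬ G₁.Conn T a b) : AdjAgree G₁ G₂ W' := by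
  have hmono : ∀ {G : SMCM V} {a b}, G.Adj W a b → G.Adj W' a b := by
    rintro G a b ⟨hne, f, g, ht⟩
    exact ⟨hne, f, g, ht.mono (Set.compl_subset_compl.2 hW) subset_rfl⟩
  intro a ha b hb
  by_cases hab : G₁.Adj W a b
  · exact ⟨fun _ => hmono ((hadj a (hW ha) b (hW hb)).1 hab), fun _ => hmono hab⟩
  · by_cases hne : a = b
    · exact ⟨fun h => absurd hne h.1, fun h => absurd hne h.1⟩
    · obtain ⟨T, hT, haT, hbT, hsep⟩ := h a ha b hb hne hab
      exact ⟨fun h => absurd (Adj.conn h hT) hsep, fun h => absurd (hle a (hW ha) b (hW hb) hne T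
        (hT.trans hW) haT hbT (Adj.conn h hT)) hsep⟩

theorem adjAgree_diff_sink (hadj : AdjAgree G₁ G₂ W) (hle : ConnLE G₂ G₁ W)
    (hs : ∀ w ∈ W, G₁.IsAncestor s w → w = s) : AdjAgree G₁ G₂ (W \ {s}) := by
  refine adjAgree_of_separators Set.sdiff_subset hadj hle ?_
  rintro a ⟨ha, has⟩ b ⟨hb, hbs⟩ hne hab
  refine ⟨_, ?_, ?_, ?_, not_conn_of_not_adj hne ha hb hab⟩
  · rintro v ⟨⟨⟨w, hw, hvw⟩, hv⟩, -⟩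
    refine ⟨hv, ?_⟩
    rintro rfl
    rcases hw with rfl | rfl
    · exact has (hs _ ha hvw)
    · exact hbs (hs _ hb hvw)
  · simp
  · simp

/-- In the smallest ancestral set containing `s` and `b`, the vertices with a collider path to `s`
separate it from `b` if they do not include `b`. -/
theorem not_conn_markovBlanket {b : V} (hne : s ≠ b)
    (h : ¬ G.Adj W s b) :
    ¬ G.Conn {t | t ∈ W ∧ t ∈ G.anc {s, b} ∧ t ≠ s ∧
      ∃ f g, G.Trek Wᶜ (G.anc {s, b}) s f g t} s b := by
  rintro ⟨f, g, ht⟩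
  set T := {t | t ∈ W ∧ t ∈ G.anc {s, b} ∧ t ≠ s ∧
    ∃ f g, G.Trek Wᶜ (G.anc {s, b}) s f g t} with hT
  have hTa : G.anc T ⊆ G.anc {s, b} := anc_subset_anc fun t ht => ht.2.1
  obtain ⟨f, ht⟩ := ht.avoid_left
  have ht := trek_inter_lower (D := G.anc {s, b}) (fun _ _ h₁ h₂ => anc_lower h₁ h₂)
    (Set.sdiff_subset.trans hTa) ht (G.subset_anc _ (by simp)) (G.subset_anc _ (by simp))
  rcases ht.exists_first Wᶜ with ht | ⟨v, ⟨⟨⟨hvT, hvs⟩, hva⟩, hvW⟩, g', ht⟩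
  · exact h ⟨hne, f, g, ht.mono Set.inter_subset_right (Set.sdiff_subset.trans hTa)⟩
  · exact hvT ⟨by simpa using hvW, hva, hvs, f, g',
      ht.mono Set.inter_subset_right (Set.sdiff_subset.trans hTa)⟩

/-- Separators of `G₁` avoiding `t` are needed, although `t` is a sink only of `G₂`. The equivalence
known on `W \ {s}` moves statements between the graphs; it says nothing about pairs containing `s`,
for which the Markov blanket of `s` is used. -/
theorem adjAgree_diff_sink_right (hadj : AdjAgree G₁ G₂ W) (hle : ConnLE G₂ G₁ W)
    (hsW : s ∈ W) (hs : ∀ w ∈ W, G₁.IsAncestor s w → w = s) (ih : ConnLE G₁ G₂ (W \ {s}))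
    (htW : t ∈ W) (ht : ∀ w ∈ W, G₂.IsAncestor t w → w = t) (hts : t ≠ s) :
    AdjAgree G₁ G₂ (W \ {t}) := by
  have htanc : ∀ {T : Set V}, T ⊆ W → t ∉ T → t ∉ G₂.anc T := by
    rintro T hT htT ⟨w, hw, h⟩
    exact htT (ht w (hT hw) h ▸ hw)
  have hdrop : ∀ {a b : V} {T : Set V}, a ∈ W → b ∈ W → T ⊆ W → t ≠ a → t ≠ b → t ∉ T →
      t ∉ G₂.anc (insert a (insert b T)) := by
    intro a b T ha hb hT h₁ h₂ h₃
    exact htanc (Set.insert_subset ha (Set.insert_subset hb hT)) (by simp [h₁, h₂, h₃])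
  have one : ∀ b ∈ W \ {t}, s ≠ b → ¬ G₁.Adj W s b →
      ∃ T ⊆ W \ {t}, s ∉ T ∧ b ∉ T ∧ ¬ G₁.Conn T s b := by
    rintro b ⟨hb, hbt⟩ hne hnadj
    have hbt : b ≠ t := hbt
    have hsep := not_conn_markovBlanket hne hnadj
    set T := {t | t ∈ W ∧ t ∈ G₁.anc {s, b} ∧ t ≠ s ∧
      ∃ f g, G₁.Trek Wᶜ (G₁.anc {s, b}) s f g t} with hT
    have hTW : T ⊆ W := fun t h => h.1
    have hsT : s ∉ T := fun h => h.2.2.1 rfl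
    have hbT : b ∉ T := fun ⟨_, _, _, h⟩ => hnadj ⟨hne, h⟩
    by_cases htT : t ∈ T
    · have hT' : insert t (T \ {t}) = T := by simp [htT]
      have hT'W : T \ {t} ⊆ W := Set.sdiff_subset.trans hTW
      refine ⟨T \ {t}, Set.sdiff_subset_sdiff_left hTW, fun h => hsT h.1, fun h => hbT h.1, ?_⟩
      -- A minimal collider path from `s` to `t` among the ancestors of `s` and `b` has its inner
      -- vertices in the blanket again, so it connects in `G₂`.
      have hst : G₂.Conn (T \ {t}) s t := by
        obtain ⟨-, hta, -, f, g, hk⟩ := htT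
        have hlow : G₁.anc {s, b} ⊆ G₁.anc (G₁.anc {s, b} ∩ W) := G₁.anc_mono (by
          rintro w (rfl | rfl)
          exacts [⟨G₁.subset_anc _ (by simp), hsW⟩, ⟨G₁.subset_anc _ (by simp), hb⟩])
        obtain ⟨n, q, hq, h0, hn, hqB⟩ := exists_minimalColliderPath (G := G₁) (W := W)
          (B := G₁.anc {s, b} ∩ W) (x := s) (y := t)
          (fun v hv h => ⟨anc_subset_anc Set.inter_subset_left h, hv⟩) Set.inter_subset_right
          ⟨G₁.subset_anc _ (by simp), hsW⟩ ⟨hta, htW⟩ hts.symm (hk.mono subset_rfl hlow)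
        have := hq.conn (Z := T \ {t}) hadj hle hT'W fun i hi hin => ?_
        · rwa [h0, hn] at this
        · refine ⟨⟨(hqB i hin.le).2, (hqB i hin.le).1, ?_, ?_⟩, ?_⟩
          · exact fun h => hq.ne 0 i hi hin.le (h0.trans h.symm)
          · have hcol : ∀ l, 0 < l → l < i →
                ¬ G₁.IsAncestor (q l) (q (l - 1)) ∧ ¬ G₁.IsAncestor (q l) (q (l + 1)) := by
              intro l h₁ h₂
              obtain ⟨l, rfl⟩ : ∃ k, l = k + 1 := ⟨l - 1, by omega⟩
              exact hq.inner l (by omega)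
            obtain ⟨f, g, htr, -⟩ := exists_segment_trek (D := G₁.anc {s, b})
              (fun _ _ h₁ h₂ => anc_lower h₁ h₂) hi (fun l _ _ => hq.adj l (by omega)) hcol
              (fun l _ _ => (hqB l (by omega)).1)
            exact ⟨f, g, h0 ▸ htr⟩
          · exact fun h => hq.ne i n hin le_rfl (h.trans hn.symm)
      have hsb₂ : ¬ G₂.Conn T s b := fun h => hsep (hle s hsW b hb hne T hTW hsT hbT h)
      -- As `t` is a sink of `G₂`, the connections from `s` to `t` and from `t` to `b` would meet at
      -- a collider in `T`.
      have htb₂ : ¬ G₂.Conn (T \ {t}) t b := by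
        intro h
        refine hsb₂ (hT' ▸ conn_of_conn_of_conn ?_ hst h)
        exact hdrop hsW hb hT'W hts hbt.symm (by simp)
      have htb₁ : ¬ G₁.Conn (T \ {t}) b t := by
        intro h
        refine htb₂ (ih t ⟨htW, hts⟩ b ⟨hb, hne.symm⟩ hbt.symm _ ?_ (by simp)
          (fun h => hbT h.1) h.symm)
        exact fun v hv => ⟨hTW hv.1, fun h => hsT (h ▸ hv.1)⟩
      intro hc
      rcases conn_or_conn (u := t) hc.symm with h | h
      · exact hsep (hT' ▸ h.symm)
      · exact htb₁ h
    · exact ⟨T, fun v hv => ⟨hTW hv, fun h => htT (h ▸ hv)⟩, hsT, hbT, hsep⟩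
  refine adjAgree_of_separators Set.sdiff_subset hadj hle ?_
  rintro a ⟨ha, hat⟩ b ⟨hb, hbt⟩ hne hnadj
  by_cases has : a = s
  · subst has
    exact one b ⟨hb, hbt⟩ hne hnadj
  by_cases hbs : b = s
  · subst hbs
    obtain ⟨T, h₁, h₂, h₃, h₄⟩ := one a ⟨ha, hat⟩ hne.symm fun h => hnadj (Adj.symm h)
    exact ⟨T, h₁, h₃, h₂, fun h => h₄ h.symm⟩
  have hsep := not_conn_of_not_adj hne ha hb hnadj
  set T := (G₁.anc {a, b} ∩ W) \ {a, b} with hT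
  have hTW : T ⊆ W := Set.sdiff_subset.trans Set.inter_subset_right
  have hsT : s ∉ T := by
    rintro ⟨⟨⟨w, rfl | rfl, h⟩, -⟩, -⟩
    exacts [has (hs _ ha h), hbs (hs _ hb h)]
  have haT : a ∉ T := by simp [hT]
  have hbT : b ∉ T := by simp [hT]
  refine ⟨T \ {t}, Set.sdiff_subset_sdiff_left hTW, fun h => haT h.1, fun h => hbT h.1, fun hc => ?_⟩
  -- Move to `G₂`, where adding the sink `t` to the conditioning set is harmless, and return to `G₁`
  -- with the full separator.
  have hc₂ := ih a ⟨ha, has⟩ b ⟨hb, hbs⟩ hne (T \ {t})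
    (fun v hv => ⟨hTW hv.1, fun h => hsT (h ▸ hv.1)⟩) (fun h => haT h.1) (fun h => hbT h.1) hc
  refine hsep (hle a ha b hb hne T hTW haT hbT ?_)
  by_cases htT : t ∈ T
  · have hT' : insert t (T \ {t}) = T := by simp [htT]
    rw [← hT']
    exact conn_insert (hdrop ha hb (Set.sdiff_subset.trans hTW) (Ne.symm hat) (Ne.symm hbt)
      (by simp)) hc₂
  · rwa [Set.sdiff_singleton_eq_self htT] at hc₂

/-- It suffices to compare connections given all other members of an ancestral set. -/
theorem connLE_of_ancestral (h : ∀ B ⊆ W, (∀ v ∈ W, v ∈ G₂.anc B → v ∈ B) → ∀ x ∈ B, ∀ y ∈ B,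
    x ≠ y → G₁.Conn (B \ {x, y}) x y → G₂.Conn (B \ {x, y}) x y) : ConnLE G₁ G₂ W := by
  intro x hx y hy hne Z hZW hxZ hyZ hc
  by_contra hsep
  set A := G₂.anc (insert x (insert y Z)) with hA
  have hZA : Z ⊆ A := fun z hz => G₂.subset_anc _ (by simp [hz])
  have hxA : x ∈ A := G₂.subset_anc _ (by simp)
  have hyA : y ∈ A := G₂.subset_anc _ (by simp)
  -- Reachability from `x` in `G₂`, with colliders allowed anywhere in `A`; by `conn_of_trek` it
  -- does not include `y`. By hypothesis a `G₁`-connection given the rest of `B` would extend it,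
  -- whence `pair`.
  let R : V → Prop := fun v => v = x ∨ ∃ a b, G₂.Trek Zᶜ A x a b v
  have hyR : ¬ R y := by
    rintro (h | ⟨a, b, h⟩)
    exacts [hne h.symm, hsep (conn_of_trek h)]
  set B := A ∩ W with hB
  have pair : ∀ x' ∈ B, x' ∉ Z → R x' → ∀ y' ∈ B, y' ∉ Z → ¬ R y' →
      ¬ G₁.Conn (B \ {x', y'}) x' y' := by
    intro x' hx' hx'Z hRx y' hy' hy'Z hRy hc
    have hne' : x' ≠ y' := fun h => hRy (h ▸ hRx)
    obtain ⟨a, b, ht⟩ := h B Set.inter_subset_right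
      (fun v hv h => ⟨anc_subset_anc Set.inter_subset_left h, hv⟩) x' hx' y' hy' hne' hc
    have ht : G₂.Trek Zᶜ A x' a b y' := by
      refine ht.mono (Set.compl_subset_compl.2 fun z hz => ⟨⟨hZA hz, hZW hz⟩, ?_⟩)
        (anc_subset_anc (Set.sdiff_subset.trans Set.inter_subset_left))
      rintro (rfl | rfl)
      exacts [hx'Z hz, hy'Z hz]
    rcases hRx with rfl | ⟨c, d, ht'⟩
    · exact hRy (.inr ⟨_, _, ht⟩)
    · exact hRy (.inr ⟨_, _, ht'.join ht (fun _ _ => hx'.1) (fun _ => hx'Z)⟩)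
  obtain ⟨a, b, ht⟩ := hc
  -- Cut the `G₁`-walk where its non-colliders in `B` first leave `R`, then cut again at the last
  -- one before that in `R`, if any. The piece between has no non-collider in `B`, contradicting
  -- `pair`.
  obtain ⟨y', hy'B, hy'Z, hRy, b, ht⟩ : ∃ y' ∈ B, y' ∉ Z ∧ ¬ R y' ∧ ∃ b,
      G₁.Trek (Zᶜ ∩ {v | v ∈ B → R v}) (G₁.anc Z) x a b y' := by
    rcases ht.exists_first {v | v ∈ B → R v} with ht | ⟨v, ⟨hvZ, hv⟩, b, ht⟩
    · exact ⟨y, ⟨hyA, hy⟩, hyZ, hyR, b, ht⟩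
    · have hv : ¬ (v ∈ B → R v) := hv
      push Not at hv
      exact ⟨v, hv.1, hvZ, hv.2, b, ht⟩
  obtain ⟨x', hx'B, hx'Z, hRx, a, ht⟩ : ∃ x' ∈ B, x' ∉ Z ∧ R x' ∧ ∃ a,
      G₁.Trek ((Zᶜ ∩ {v | v ∈ B → R v}) ∩ {v | v ∈ B → ¬ R v}) (G₁.anc Z) y' b a x' := by
    rcases ht.symm.exists_first {v | v ∈ B → ¬ R v} with ht | ⟨v, ⟨hvZ, hv⟩, a, ht⟩
    · exact ⟨x, ⟨hxA, hx⟩, hxZ, .inl rfl, a, ht⟩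
    · have hv : ¬ (v ∈ B → ¬ R v) := hv
      push Not at hv
      exact ⟨v, hv.1, hvZ.1, hv.2, a, ht⟩
  refine pair x' hx'B hx'Z hRx y' hy'B hy'Z hRy ⟨a, b, ht.symm.mono ?_ (G₁.anc_mono ?_)⟩
  · rintro v ⟨⟨-, h₁⟩, h₂⟩ ⟨hvB, -⟩
    exact h₂ hvB (h₁ hvB)
  · refine fun z hz => ⟨⟨hZA hz, hZW hz⟩, ?_⟩
    rintro (rfl | rfl)
    exacts [hx'Z hz, hy'Z hz]

/-- A graph with the same virtual adjacencies and fewer m-connections has the same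
m-connections. -/
theorem connLE_of_adjAgree [Finite V] (W : Set V) (hadj : AdjAgree G₁ G₂ W)
    (hle : ConnLE G₂ G₁ W) : ConnLE G₁ G₂ W := by
  induction W using WellFoundedLT.induction with
  | ind W ih =>
  rcases W.eq_empty_or_nonempty with rfl | hW
  · exact fun x hx => absurd hx (Set.notMem_empty x)
  have hlt : ∀ t ∈ W, W \ {t} < W := fun t ht => Set.sdiff_singleton_ssubset.2 ht
  obtain ⟨s, hsW, hs⟩ := G₁.exists_sink hW
  have ihs : ConnLE G₁ G₂ (W \ {s}) :=
    ih _ (hlt s hsW) (adjAgree_diff_sink hadj hle hs) (hle.mono Set.sdiff_subset)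
  -- The order matters: the result for a sink of `G₁` is an input to the removal of a sink of `G₂`.
  have iht : ∀ t ∈ W, (∀ w ∈ W, G₂.IsAncestor t w → w = t) → ConnLE G₁ G₂ (W \ {t}) := by
    intro t htW ht
    by_cases hts : t = s
    · exact hts ▸ ihs
    · exact ih _ (hlt t htW) (adjAgree_diff_sink_right hadj hle hsW hs ihs htW ht hts)
        (hle.mono Set.sdiff_subset)
  refine connLE_of_ancestral fun B hBW hB x hx y hy hne hc => ?_
  have hZB : B \ {x, y} ⊆ B := Set.sdiff_subset
  rcases (W \ B).eq_empty_or_nonempty with hBe | hBne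
  · obtain rfl : B = W := hBW.antisymm (Set.sdiff_eq_empty.1 hBe)
    have hB₁ : ∀ v ∈ B, v ∈ G₁.anc B → v ∈ B := fun v hv _ => hv
    obtain ⟨a, b, ht⟩ := trek_of_conn hB₁ hx hy hZB hc (fun v hv h₁ h₂ => ⟨hv, by simp [h₁, h₂]⟩)
    obtain ⟨n, q, hq, rfl, rfl, -⟩ := exists_minimalColliderPath hB₁ subset_rfl hx hy hne
      (ht.mono subset_rfl (G₁.anc_mono hZB))
    refine hq.conn hadj hle hZB fun i hi hin => ⟨hq.mem i hin.le, ?_⟩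
    rintro (h | h)
    exacts [hq.ne 0 i hi hin.le h.symm, hq.ne i n hin le_rfl h]
  -- A sink of `W \ B` is a sink of `W`, because `B` is ancestral in `G₂`.
  · obtain ⟨t, ⟨htW, htB⟩, ht⟩ := G₂.exists_sink hBne
    have ht' : ∀ w ∈ W, G₂.IsAncestor t w → w = t := fun w hw h =>
      ht w ⟨hw, fun hwB => htB (hB t htW ⟨w, hwB, h⟩)⟩ h
    have hB' : B ⊆ W \ {t} := fun v hv => ⟨hBW hv, fun h => htB (h ▸ hv)⟩
    exact iht t htW ht' x (hB' hx) y (hB' hy) hne _ (hZB.trans hB') (by simp) (by simp) hc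

end SMCM

/-! ### Faithfulness and the three assumptions. -/

namespace SMCM

open MixedGraph

section

variable {V : Type u} {G G₁ G₂ : SMCM V} {x y : V} {Z : Set V}

theorem mSep_singleton_iff (hne : x ≠ y) : G.MSep {x} {y} Z ↔ ¬ G.Conn Z x y := by
  rw [mSep_iff (Set.disjoint_singleton.2 hne)]
  simp

theorem exists_separator (hne : x ≠ y) (h : ¬ G.VirtuallyAdjacent x y) :
    ∃ Z : Set V, x ∉ Z ∧ y ∉ Z ∧ ¬ G.Conn Z x y := by
  rw [virtuallyAdjacent_iff] at h
  exact ⟨_, by simp, by simp, not_conn_of_not_adj hne (Set.mem_univ _) (Set.mem_univ _) h⟩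

theorem conn_of_virtuallyAdjacent (h : G.VirtuallyAdjacent x y) (Z : Set V) : G.Conn Z x y :=
  Adj.conn (virtuallyAdjacent_iff.1 h) (Set.subset_univ Z)

theorem pairwiseDisjoint_singleton (hne : x ≠ y) (hx : x ∉ Z) (hy : y ∉ Z) :
    PairwiseDisjoint₃ {x} {y} Z := by
  simp [PairwiseDisjoint₃, hne, hx, hy]

/-- The unordered pairs of virtually adjacent vertices. -/
def vAdjPairs (G : SMCM V) : Set (Sym2 V) :=
  {s | ∃ x y, s = s(x, y) ∧ G.VirtuallyAdjacent x y}

theorem mk_mem_vAdjPairs : s(x, y) ∈ G.vAdjPairs ↔ G.VirtuallyAdjacent x y := by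
  constructor
  · rintro ⟨a, b, he, h⟩
    rcases Sym2.eq_iff.1 he with ⟨rfl, rfl⟩ | ⟨rfl, rfl⟩
    · exact h
    · exact virtuallyAdjacent_iff.2 (Adj.symm (virtuallyAdjacent_iff.1 h))
  · exact fun h => ⟨x, y, rfl, h⟩

theorem vAdjPairs_subset_iff : G₁.vAdjPairs ⊆ G₂.vAdjPairs ↔
    ∀ x y, G₁.VirtuallyAdjacent x y → G₂.VirtuallyAdjacent x y := by
  constructor
  · exact fun h x y hxy => mk_mem_vAdjPairs.1 (h (mk_mem_vAdjPairs.2 hxy))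
  · rintro h _ ⟨x, y, rfl, hxy⟩
    exact ⟨x, y, rfl, h x y hxy⟩

/-- The conditional independence statements entailed by a graph. -/
def independencies (G : SMCM V) : Set (Set V × Set V × Set V) :=
  {t | PairwiseDisjoint₃ t.1 t.2.1 t.2.2 ∧ G.MSep t.1 t.2.1 t.2.2}

theorem not_conn_of_independencies_subset (h : G₁.independencies ⊆ G₂.independencies)
    (hne : x ≠ y) (hx : x ∉ Z) (hy : y ∉ Z) (hc : ¬ G₁.Conn Z x y) :
    ¬ G₂.Conn Z x y :=
  (mSep_singleton_iff hne).1 (h (a := ({x}, {y}, Z))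
    ⟨pairwiseDisjoint_singleton hne hx hy, (mSep_singleton_iff hne).2 hc⟩).2

end

variable {V : Type u} [Finite V] {S : V → Type v} [∀ i, MeasurableSpace (S i)]
  [∀ i, StandardBorelSpace (S i)] {P : ProbabilityMeasure (∀ i, S i)} {G G₀ : SMCM V}

theorem independencies_subset (hM : Markov G P) (hF : Faithful G₀ P) :
    G.independencies ⊆ G₀.independencies :=
  fun _ ht => ⟨ht.1, hF _ _ _ ht.1 (hM _ _ _ ht.1 ht.2)⟩

theorem vAdjPairs_subset (hM : Markov G P) (hF : Faithful G₀ P) :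
    G₀.vAdjPairs ⊆ G.vAdjPairs := by
  rw [vAdjPairs_subset_iff]
  intro x y h
  by_contra hn
  obtain ⟨Z, hx, hy, hc⟩ := exists_separator h.1 hn
  exact not_conn_of_independencies_subset (independencies_subset hM hF) h.1 hx hy hc
    (conn_of_virtuallyAdjacent h Z)

theorem faithful_of_independencies_subset (h : G₀.independencies ⊆ G.independencies)
    (hF : Faithful G₀ P) : Faithful G P :=
  fun X Y Z hd hc => (h (a := (X, Y, Z)) ⟨hd, hF X Y Z hd hc⟩).2

/-- The only use of the graph theorem: both V-adjacency assumptions enter through this inclusion. -/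
theorem faithful_of_vAdjPairs_subset (hM : Markov G P) (hF : Faithful G₀ P)
    (h : G.vAdjPairs ⊆ G₀.vAdjPairs) : Faithful G P := by
  have hsub := independencies_subset hM hF
  have hadj : AdjAgree G G₀ Set.univ := fun x _ y _ => by
    rw [← virtuallyAdjacent_iff, ← virtuallyAdjacent_iff]
    exact ⟨vAdjPairs_subset_iff.1 h x y, vAdjPairs_subset_iff.1 (vAdjPairs_subset hM hF) x y⟩
  have hle : ConnLE G₀ G Set.univ := fun x _ y _ hne Z _ hx hy hc => by
    by_contra hn
    exact not_conn_of_independencies_subset hsub hne hx hy hn hc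
  have key := connLE_of_adjAgree Set.univ hadj hle
  refine faithful_of_independencies_subset ?_ hF
  rintro ⟨X, Y, Z⟩ ⟨hd, hs⟩
  refine ⟨hd, (mSep_iff hd.1).2 fun x hx y hy hc => (mSep_iff hd.1).1 hs x hx y hy ?_⟩
  exact key x (Set.mem_univ _) y (Set.mem_univ _) (hd.1.ne_of_mem hx hy) Z (Set.subset_univ _)
    (hd.2.1.notMem_of_mem_left hx) (hd.2.2.notMem_of_mem_left hy) hc

theorem vAdjFaithful_of_faithful (hF : Faithful G P) : VAdjFaithful G P := by
  intro x y hne h Z hx hy hc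
  exact (mSep_singleton_iff hne).1 (hF _ _ _ (pairwiseDisjoint_singleton hne hx hy) hc)
    (conn_of_virtuallyAdjacent h Z)

theorem vAdjMinimal_of_faithful (hF : Faithful G P) : VAdjMinimal G P := by
  rintro ⟨G', hlt, hM⟩
  exact absurd (Set.ncard_le_ncard (vAdjPairs_subset hM hF) (Set.toFinite _)) (not_le.2 hlt)

theorem noIMinimal_of_faithful (hF : Faithful G P) : NoIMinimal G P := by
  rintro ⟨G', hlt, hM⟩
  exact absurd (Set.ncard_le_ncard (independencies_subset hM hF) (Set.toFinite _)) (not_le.2 hlt)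

theorem faithful_of_vAdjFaithful (hM : Markov G P) (hM₀ : Markov G₀ P) (hF₀ : Faithful G₀ P)
    (h : VAdjFaithful G P) : Faithful G P := by
  refine faithful_of_vAdjPairs_subset hM hF₀ (vAdjPairs_subset_iff.2 fun x y hxy => ?_)
  by_contra hn
  obtain ⟨Z, hx, hy, hc⟩ := exists_separator hxy.1 hn
  exact h x y hxy.1 hxy Z hx hy (hM₀ _ _ _ (pairwiseDisjoint_singleton hxy.1 hx hy)
    ((mSep_singleton_iff hxy.1).2 hc))

theorem faithful_of_vAdjMinimal (hM : Markov G P) (hM₀ : Markov G₀ P) (hF₀ : Faithful G₀ P)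
    (h : VAdjMinimal G P) : Faithful G P := by
  refine faithful_of_vAdjPairs_subset hM hF₀ (Set.eq_of_subset_of_ncard_le
    (vAdjPairs_subset hM hF₀) ?_ (Set.toFinite _)).symm.subset
  exact not_lt.1 fun hlt => h ⟨G₀, hlt, hM₀⟩

theorem faithful_of_noIMinimal (hM : Markov G P) (hM₀ : Markov G₀ P) (hF₀ : Faithful G₀ P)
    (h : NoIMinimal G P) : Faithful G P := by
  refine faithful_of_independencies_subset (Set.eq_of_subset_of_ncard_le
    (independencies_subset hM hF₀) ?_ (Set.toFinite _)).symm.subset hF₀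
  exact not_lt.1 fun hlt => h ⟨G₀, hlt, hM₀⟩

end SMCM

/-! ### The counterexample: graphs on three vertices. -/

namespace IntransitiveChain

open MixedGraph SMCM

/-- Three vertices. -/
abbrev Vertex : Type u := ULift.{u} (Fin 3)

/-- The source of the chain. -/
abbrev n0 : Vertex.{u} := ⟨0⟩
/-- The middle vertex of the chain. -/
abbrev n1 : Vertex.{u} := ⟨1⟩
/-- The sink of the chain. -/
abbrev n2 : Vertex.{u} := ⟨2⟩

theorem vertex_cases (i : Vertex.{u}) : i = n0 ∨ i = n1 ∨ i = n2 := by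
  obtain ⟨i⟩ := i
  fin_cases i <;> simp

/-- The chain `n0 → n1 → n2`. -/
def chain : SMCM Vertex.{u} where
  dir x y := x.down.val + 1 = y.down.val
  bi _ _ := False
  dir_irrefl x := by omega
  bi_irrefl _ := id
  bi_symm _ _ := id
  acyclic := by
    have key : ∀ x y : Vertex.{u}, Relation.ReflTransGen
        (fun x y : Vertex.{u} => x.down.val + 1 = y.down.val) x y → x.down.val ≤ y.down.val := by
      intro x y h
      induction h with
      | refl => exact le_rfl
      | tail _ h ih => omega
    intro x y hxy hyx
    exact ULift.ext _ _ (Fin.ext (le_antisymm (key x y hxy) (key y x hyx)))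

theorem chain_dir_n0 : chain.dir n0.{u} n1 := rfl

theorem chain_dir_n1 : chain.dir n1.{u} n2 := rfl

/-- With all vertices observed a trek has colliders only. A vertex of the chain has at most one
parent, so a collider merely sends the trek back to its start. -/
theorem chain_not_adj : ¬ chain.Adj Set.univ n0.{u} n2 := by
  have key : ∀ {C : Set Vertex.{u}} {x y a b}, chain.Trek Set.univᶜ C x a b y →
      (chain.dir x y ∧ a = false ∧ b = true) ∨ (chain.dir y x ∧ a = true ∧ b = false) ∨
        (x = y ∧ a = false ∧ b = false) := by
    intro C x y a b h
    induction h with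
    | fwd h => exact .inl ⟨h, rfl, rfl⟩
    | bwd h => exact .inr (.inl ⟨h, rfl, rfl⟩)
    | bidir h => exact h.elim
    | @collider x v y a b _ _ _ ih₁ ih₂ =>
      simp only [and_false, reduceCtorEq, or_false, false_or, and_true, false_and, true_and]
        at ih₁ ih₂
      refine .inr (.inr ⟨ULift.ext _ _ (Fin.ext ?_), ih₁.2, ih₂.2⟩)
      have h₁ : x.down.val + 1 = v.down.val := ih₁.1
      have h₂ : y.down.val + 1 = v.down.val := ih₂.1
      omega
    | noncollider _ _ _ h => simp at h
  rintro ⟨-, a, b, h⟩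
  rcases key h with ⟨h, -⟩ | ⟨h, -⟩ | ⟨h, -⟩
  · exact absurd h (by simp [chain])
  · exact absurd h (by simp [chain])
  · simp at h

theorem chain_adj₀₁ : chain.Adj Set.univ n0.{u} n1 := ⟨by simp, _, _, .fwd chain_dir_n0.{u}⟩

theorem chain_adj₁₂ : chain.Adj Set.univ n1.{u} n2 := ⟨by simp, _, _, .fwd chain_dir_n1.{u}⟩

theorem chain_not_conn : ¬ chain.Conn {n1} n0.{u} n2 := by
  have h := not_conn_of_not_adj (by simp) (Set.mem_univ _) (Set.mem_univ _) chain_not_adj.{u}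
  have h₁ : n1.{u} ∈ chain.anc {n0.{u}, n2} := ⟨n2, by simp, .single chain_dir_n1.{u}⟩
  have he : (chain.anc {n0.{u}, n2} ∩ Set.univ) \ {n0, n2} = {n1} := by
    ext i
    rcases vertex_cases i with rfl | rfl | rfl <;> simp [h₁]
  rwa [he] at h

theorem chain_conn : chain.Conn ∅ n0.{u} n2 :=
  ⟨_, _, .noncollider (.fwd chain_dir_n0.{u}) (.fwd chain_dir_n1.{u}) (.inr rfl) (by simp)⟩

/-- If both links are virtual adjacencies, then the ends cannot be separated both by the empty set
and by the middle vertex. -/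
theorem conn_or_conn_of_adj {G : SMCM Vertex.{u}} (h₁ : G.Adj Set.univ n0 n1)
    (h₂ : G.Adj Set.univ n1 n2) : G.Conn ∅ n0 n2 ∨ G.Conn {n1} n0 n2 := by
  have c₁ : G.Conn ∅ n0 n1 := Adj.conn h₁ (Set.subset_univ _)
  have c₂ : G.Conn ∅ n1 n2 := Adj.conn h₂ (Set.subset_univ _)
  -- If `n1` is an ancestor of an end it can be passed given `∅` whatever the arrowheads; otherwise
  -- it is a collider, opened by conditioning on it.
  by_cases h : n1 ∈ G.anc (insert n0 (insert n2 ∅))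
  · left
    obtain ⟨a, b, c₁⟩ := c₁
    obtain ⟨c, d, c₂⟩ := c₂
    have hsub := G.anc_mono (Set.empty_subset (insert n0 (insert n2 ∅)))
    exact conn_of_trek ((c₁.mono subset_rfl hsub).join (c₂.mono subset_rfl hsub) (fun _ _ => h)
      (by simp))
  · right
    simpa using conn_of_conn_of_conn h c₁ c₂

theorem sets_of_pairs {X Y Z : Set Vertex.{u}} (hd : PairwiseDisjoint₃ X Y Z) (hX : X.Nonempty)
    (hY : Y.Nonempty) (h : ∀ x ∈ X, ∀ y ∈ Y, (x = n0 ∧ y = n2) ∨ (x = n2 ∧ y = n0)) :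
    ((X = {n0} ∧ Y = {n2}) ∨ (X = {n2} ∧ Y = {n0})) ∧ (Z = ∅ ∨ Z = {n1}) := by
  have key : ∀ {X Y : Set Vertex.{u}} {a b : Vertex.{u}}, a ≠ b → a ∈ X → b ∈ Y →
      (∀ x ∈ X, ∀ y ∈ Y, (x = a ∧ y = b) ∨ (x = b ∧ y = a)) → X = {a} ∧ Y = {b} := by
    intro X Y a b hab ha hb h
    refine ⟨Set.eq_singleton_iff_unique_mem.2 ⟨ha, fun x hx => ?_⟩,
      Set.eq_singleton_iff_unique_mem.2 ⟨hb, fun y hy => ?_⟩⟩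
    · rcases h x hx b hb with h | h
      exacts [h.1, absurd h.2.symm hab]
    · rcases h a ha y hy with h | h
      exacts [h.2, absurd h.1 hab]
  obtain ⟨x, hx⟩ := hX
  obtain ⟨y, hy⟩ := hY
  have hXY : (X = {n0} ∧ Y = {n2}) ∨ (X = {n2} ∧ Y = {n0}) := by
    rcases h x hx y hy with ⟨rfl, rfl⟩ | ⟨rfl, rfl⟩
    · exact .inl (key (by simp) hx hy h)
    · exact .inr (key (by simp) hx hy fun x hx y hy => (h x hx y hy).symm)
  refine ⟨hXY, Set.subset_singleton_iff_eq.1 fun z hz => ?_⟩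
  obtain ⟨-, h₁, h₂⟩ := hd
  rcases hXY with ⟨rfl, rfl⟩ | ⟨rfl, rfl⟩ <;>
  · rw [Set.disjoint_singleton_left] at h₁ h₂
    rcases vertex_cases z with rfl | rfl | rfl
    · contradiction
    · rfl
    · contradiction

theorem pair_cases {x y : Vertex.{u}} (hne : x ≠ y) (h₀₁ : ¬ (x = n0 ∧ y = n1))
    (h₁₀ : ¬ (x = n1 ∧ y = n0)) (h₁₂ : ¬ (x = n1 ∧ y = n2)) (h₂₁ : ¬ (x = n2 ∧ y = n1)) :
    (x = n0 ∧ y = n2) ∨ (x = n2 ∧ y = n0) := by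
  rcases vertex_cases x with rfl | rfl | rfl <;> rcases vertex_cases y with rfl | rfl | rfl <;>
    simp_all

section

variable {S : Vertex.{u} → Type v} [∀ i, MeasurableSpace (S i)] [∀ i, StandardBorelSpace (S i)]
  {P : ProbabilityMeasure (∀ i, S i)}

theorem condIndepVars_symm {X Y Z : Set Vertex.{u}} (h : CondIndepVars P X Y Z) :
    CondIndepVars P Y X Z :=
  ProbabilityTheory.CondIndepFun.symm h

theorem condIndepVars_empty_left (Y Z : Set Vertex.{u}) : CondIndepVars P ∅ Y Z := by
  unfold CondIndepVars
  have : (fun (ω : ∀ i, S i) (i : (∅ : Set Vertex.{u})) => ω i) =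
      fun _ => fun i => i.2.elim := by
    funext ω i
    exact i.2.elim
  rw [this]
  exact ProbabilityTheory.condIndepFun_const_left _ _

theorem chain_markov (h : CondIndepVars P {n0} {n2} {n1}) : Markov chain P := by
  intro X Y Z hd hs
  rcases X.eq_empty_or_nonempty with rfl | hX
  · exact condIndepVars_empty_left _ _
  rcases Y.eq_empty_or_nonempty with rfl | hY
  · exact condIndepVars_symm (condIndepVars_empty_left _ _)
  rw [mSep_iff hd.1] at hs
  have conn : ∀ {x y}, chain.Adj Set.univ x y → chain.Conn Z x y :=
    fun h => Adj.conn h (Set.subset_univ _)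
  obtain ⟨hXY, hZ⟩ := sets_of_pairs hd hX hY fun x hx y hy => by
    have hc := hs x hx y hy
    refine pair_cases (hd.1.ne_of_mem hx hy) ?_ ?_ ?_ ?_ <;> rintro ⟨rfl, rfl⟩
    exacts [hc (conn chain_adj₀₁), hc (conn chain_adj₀₁).symm, hc (conn chain_adj₁₂),
      hc (conn chain_adj₁₂).symm]
  have hZ : Z = {n1} := by
    rcases hZ with rfl | rfl
    · rcases hXY with ⟨rfl, rfl⟩ | ⟨rfl, rfl⟩
      · exact absurd chain_conn (hs _ rfl _ rfl)
      · exact absurd chain_conn.symm (hs _ rfl _ rfl)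
    · rfl
  subst hZ
  rcases hXY with ⟨rfl, rfl⟩ | ⟨rfl, rfl⟩
  exacts [h, condIndepVars_symm h]

theorem chain_not_faithful (h : CondIndepVars P {n0} {n2} ∅) : ¬ Faithful chain P := fun hF =>
  (mSep_singleton_iff (by simp)).1
    (hF _ _ _ (pairwiseDisjoint_singleton (by simp) (by simp) (by simp)) h) chain_conn

/-- The neighbours on the chain are dependent given everything else. -/
def NeighboursDependent (P : ProbabilityMeasure (∀ i, S i)) : Prop :=
  (∀ Z ⊆ {n2}, ¬ CondIndepVars P {n0} {n1} Z) ∧ (∀ Z ⊆ {n0}, ¬ CondIndepVars P {n1} {n2} Z)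

theorem subset_n2 {Z : Set Vertex.{u}} (h₀ : n0 ∉ Z) (h₁ : n1 ∉ Z) : Z ⊆ {n2} := by
  intro z hz
  rcases vertex_cases z with rfl | rfl | rfl
  exacts [absurd hz h₀, absurd hz h₁, rfl]

theorem subset_n0 {Z : Set Vertex.{u}} (h₁ : n1 ∉ Z) (h₂ : n2 ∉ Z) : Z ⊆ {n0} := by
  intro z hz
  rcases vertex_cases z with rfl | rfl | rfl
  exacts [rfl, absurd hz h₁, absurd hz h₂]

theorem NeighboursDependent.pair (h : NeighboursDependent P) {x y : Vertex.{u}}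
    {Z : Set Vertex.{u}} (hne : x ≠ y) (hx : x ∉ Z) (hy : y ∉ Z)
    (hc : CondIndepVars P {x} {y} Z) : (x = n0 ∧ y = n2) ∨ (x = n2 ∧ y = n0) := by
  refine pair_cases hne ?_ ?_ ?_ ?_ <;> rintro ⟨rfl, rfl⟩
  exacts [h.1 Z (subset_n2 hx hy) hc, h.1 Z (subset_n2 hy hx) (condIndepVars_symm hc),
    h.2 Z (subset_n0 hx hy) hc, h.2 Z (subset_n0 hy hx) (condIndepVars_symm hc)]

theorem NeighboursDependent.vAdjFaithful (h : NeighboursDependent P) : VAdjFaithful chain P := by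
  intro x y hne hadj Z hx hy hc
  rw [virtuallyAdjacent_iff] at hadj
  rcases h.pair hne hx hy hc with ⟨rfl, rfl⟩ | ⟨rfl, rfl⟩
  exacts [chain_not_adj hadj, chain_not_adj (Adj.symm hadj)]

theorem NeighboursDependent.adj (h : NeighboursDependent P) {G : SMCM Vertex.{u}}
    (hM : Markov G P) {x y : Vertex.{u}} (hne : x ≠ y)
    (hxy : ¬ ((x = n0 ∧ y = n2) ∨ (x = n2 ∧ y = n0))) : G.VirtuallyAdjacent x y := by
  by_contra hn
  obtain ⟨Z, hx, hy, hc⟩ := exists_separator hne hn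
  exact hxy (h.pair hne hx hy
    (hM _ _ _ (pairwiseDisjoint_singleton hne hx hy) ((mSep_singleton_iff hne).2 hc)))

theorem NeighboursDependent.vAdjMinimal (h : NeighboursDependent P) : VAdjMinimal chain P := by
  rintro ⟨G, hlt, hM⟩
  refine absurd (Set.ncard_le_ncard (vAdjPairs_subset_iff.2 fun x y hadj => ?_)
    (Set.toFinite G.vAdjPairs)) (not_le.2 hlt)
  refine h.adj hM hadj.1 ?_
  rw [virtuallyAdjacent_iff] at hadj
  rintro (⟨rfl, rfl⟩ | ⟨rfl, rfl⟩)
  exacts [chain_not_adj hadj, chain_not_adj (Adj.symm hadj)]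

open Classical in
/-- Replace the conditioning set of a nontrivial independence statement by the middle vertex. -/
noncomputable def recondition (t : Set Vertex.{u} × Set Vertex.{u} × Set Vertex.{u}) :
    Set Vertex.{u} × Set Vertex.{u} × Set Vertex.{u} :=
  if t.1.Nonempty ∧ t.2.1.Nonempty then (t.1, t.2.1, {n1}) else t

theorem NeighboursDependent.sets (h : NeighboursDependent P) {G : SMCM Vertex.{u}}
    (hM : Markov G P) {t} (ht : t ∈ G.independencies) (hX : t.1.Nonempty) (hY : t.2.1.Nonempty) :
    ((t.1 = {n0} ∧ t.2.1 = {n2}) ∨ (t.1 = {n2} ∧ t.2.1 = {n0})) ∧ (t.2.2 = ∅ ∨ t.2.2 = {n1}) := by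
  obtain ⟨hd, hs⟩ := ht
  rw [mSep_iff hd.1] at hs
  refine sets_of_pairs hd hX hY fun x hx y hy => ?_
  have hne := hd.1.ne_of_mem hx hy
  have hxZ := hd.2.1.notMem_of_mem_left hx
  have hyZ := hd.2.2.notMem_of_mem_left hy
  exact h.pair hne hxZ hyZ (hM _ _ _ (pairwiseDisjoint_singleton hne hxZ hyZ)
    ((mSep_singleton_iff hne).2 (hs x hx y hy)))

/-- In a competing Markov graph the nontrivial statements concern the two ends given `∅` or given
`n1`, and by `conn_or_conn_of_adj` not both. So `recondition` injects its statements into those of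
the chain. -/
theorem NeighboursDependent.noIMinimal (h : NeighboursDependent P) : NoIMinimal chain P := by
  rintro ⟨G, hlt, hM⟩
  refine absurd (Set.ncard_le_ncard_of_injOn (s := G.independencies)
    (t := chain.independencies) recondition ?_ ?_ (Set.toFinite _)) (not_le.2 hlt)
  · intro t ht
    by_cases hn : t.1.Nonempty ∧ t.2.1.Nonempty
    · obtain ⟨hXY, -⟩ := h.sets hM ht hn.1 hn.2
      rw [recondition, if_pos hn]
      rcases hXY with ⟨h₁, h₂⟩ | ⟨h₁, h₂⟩ <;> rw [h₁, h₂]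
      · exact ⟨pairwiseDisjoint_singleton (by simp) (by simp) (by simp),
          (mSep_singleton_iff (by simp)).2 chain_not_conn⟩
      · exact ⟨pairwiseDisjoint_singleton (by simp) (by simp) (by simp),
          (mSep_singleton_iff (by simp)).2 fun hc => chain_not_conn hc.symm⟩
    · rw [recondition, if_neg hn]
      exact ⟨ht.1, fun x hx y hy => absurd ⟨⟨x, hx⟩, ⟨y, hy⟩⟩ hn⟩
  · have adj₀₁ : G.Adj Set.univ n0 n1 :=
      virtuallyAdjacent_iff.1 (h.adj hM (by simp) (by simp))
    have adj₁₂ : G.Adj Set.univ n1 n2 :=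
      virtuallyAdjacent_iff.1 (h.adj hM (by simp) (by simp))
    have not_both : ∀ {X Y : Set Vertex.{u}},
        ((X = {n0} ∧ Y = {n2}) ∨ (X = {n2} ∧ Y = {n0})) →
        (X, Y, ∅) ∈ G.independencies → (X, Y, {n1}) ∈ G.independencies → False := by
      rintro X Y (⟨rfl, rfl⟩ | ⟨rfl, rfl⟩) ⟨-, h₁⟩ ⟨-, h₂⟩
      · rcases conn_or_conn_of_adj adj₀₁ adj₁₂ with hc | hc
        exacts [(mSep_singleton_iff (by simp)).1 h₁ hc, (mSep_singleton_iff (by simp)).1 h₂ hc]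
      · rcases conn_or_conn_of_adj adj₀₁ adj₁₂ with hc | hc
        exacts [(mSep_singleton_iff (by simp)).1 h₁ hc.symm,
          (mSep_singleton_iff (by simp)).1 h₂ hc.symm]
    rintro ⟨X, Y, Z⟩ ht ⟨X', Y', Z'⟩ ht' he
    by_cases hn : X.Nonempty ∧ Y.Nonempty
    · by_cases hn' : X'.Nonempty ∧ Y'.Nonempty
      · simp only [recondition, hn, hn', and_self, if_true, Prod.mk.injEq, and_true] at he
        obtain ⟨rfl, rfl⟩ := he
        obtain ⟨hXY, hZ⟩ := h.sets hM ht hn.1 hn.2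
        obtain ⟨-, hZ'⟩ := h.sets hM ht' hn.1 hn.2
        simp only at hXY hZ hZ'
        rcases hZ with rfl | rfl <;> rcases hZ' with rfl | rfl
        · rfl
        · exact (not_both hXY ht ht').elim
        · exact (not_both hXY ht' ht).elim
        · rfl
      · simp only [recondition, hn, hn', and_self, if_true, if_false, Prod.mk.injEq] at he
        exact absurd (he.1 ▸ he.2.1 ▸ hn) hn'
    · by_cases hn' : X'.Nonempty ∧ Y'.Nonempty
      · simp only [recondition, hn, hn', and_self, if_true, if_false, Prod.mk.injEq] at he
        exact absurd (he.1 ▸ he.2.1 ▸ hn') hn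
      · simpa only [recondition, hn, hn', if_false] using he

end

end IntransitiveChain

/-! ### The counterexample: the distribution. -/

namespace IntransitiveChain

open ProbabilityTheory

theorem condIndepFun_congr_left {Ω β γ : Type*} {m' mΩ : MeasurableSpace Ω}
    [StandardBorelSpace Ω] [MeasurableSpace β] [MeasurableSpace γ] {hm' : m' ≤ mΩ}
    {μ : Measure Ω} [IsFiniteMeasure μ] {f f' : Ω → β} {g : Ω → γ} (hf : Measurable f)
    (hf' : Measurable f') (hg : Measurable g) (he : f =ᵐ[μ] f')
    (h : CondIndepFun m' hm' f g μ) : CondIndepFun m' hm' f' g μ := by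
  rw [condIndepFun_iff_condExp_inter_preimage_eq_mul hf hg] at h
  rw [condIndepFun_iff_condExp_inter_preimage_eq_mul hf' hg]
  intro s t hs ht
  have e₁ : μ⟦f ⁻¹' s ∩ g ⁻¹' t | m'⟧ =ᵐ[μ] μ⟦f' ⁻¹' s ∩ g ⁻¹' t | m'⟧ := by
    refine condExp_congr_ae (indicator_ae_eq_of_ae_eq_set (Filter.eventuallyEq_set.2 ?_))
    filter_upwards [he] with ω hω
    simp only [Set.mem_inter_iff, Set.mem_preimage, hω]
  have e₂ : μ⟦f ⁻¹' s | m'⟧ =ᵐ[μ] μ⟦f' ⁻¹' s | m'⟧ := by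
    refine condExp_congr_ae (indicator_ae_eq_of_ae_eq_set (Filter.eventuallyEq_set.2 ?_))
    filter_upwards [he] with ω hω
    simp only [Set.mem_preimage, hω]
  filter_upwards [h s t hs ht, e₁, e₂] with ω h₁ h₂ h₃
  rw [← h₂, h₁, h₃]

/-- An event that is determined, up to null sets, by either variable and that is independent of
the conditioning variables makes the two variables conditionally dependent. -/
theorem not_condIndepFun_of_common_event {Ω β γ : Type*} {m' mΩ : MeasurableSpace Ω}
    [StandardBorelSpace Ω] [MeasurableSpace β] [MeasurableSpace γ] {hm' : m' ≤ mΩ}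
    {μ : Measure Ω} [IsProbabilityMeasure μ] {f : Ω → β} {g : Ω → γ}
    (hf : Measurable f) (hg : Measurable g)
    (hi : Indep (MeasurableSpace.comap f inferInstance) m' μ) {s : Set β} {t : Set γ}
    (hs : MeasurableSet s) (ht : MeasurableSet t) (he : f ⁻¹' s =ᵐ[μ] g ⁻¹' t)
    (h₀ : μ.real (f ⁻¹' s) ≠ 0) (h₁ : μ.real (f ⁻¹' s) ≠ 1) : ¬ CondIndepFun m' hm' f g μ := by
  intro h
  rw [condIndepFun_iff_condExp_inter_preimage_eq_mul hf hg] at h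
  have hind : ∀ {A B : Set Ω}, A =ᵐ[μ] B →
      (A.indicator fun _ => (1 : ℝ)) =ᵐ[μ] B.indicator fun _ => (1 : ℝ) := fun h =>
    indicator_ae_eq_of_ae_eq_set h
  have e₁ : μ⟦f ⁻¹' s ∩ g ⁻¹' t | m'⟧ =ᵐ[μ] μ⟦f ⁻¹' s | m'⟧ := by
    refine condExp_congr_ae (hind ?_)
    have := (Filter.EventuallyEq.refl (ae μ) (f ⁻¹' s)).inter he.symm
    simpa using this
  have e₂ : μ⟦g ⁻¹' t | m'⟧ =ᵐ[μ] μ⟦f ⁻¹' s | m'⟧ := condExp_congr_ae (hind he.symm)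
  have e₃ : μ⟦f ⁻¹' s | m'⟧ =ᵐ[μ] fun _ => μ.real (f ⁻¹' s) := by
    have := condExp_indep_eq (μ := μ) (f := (f ⁻¹' s).indicator fun _ => (1 : ℝ)) hf.comap_le hm'
      (stronglyMeasurable_const.indicator ⟨s, hs, rfl⟩) hi
    rwa [integral_indicator_const _ (hf hs), smul_eq_mul, mul_one] at this
  obtain ⟨ω, h₁', h₂', h₃', h₄'⟩ := ((h s t hs ht).and (e₁.and (e₂.and e₃))).exists
  dsimp only at h₁' h₂' h₃' h₄'
  rw [h₂', h₃', h₄'] at h₁'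
  -- The common event has constant conditional probability `p`, and conditional independence from
  -- itself forces `p = p * p`.
  have : μ.real (f ⁻¹' s) * (μ.real (f ⁻¹' s) - 1) = 0 := by linarith
  rcases mul_eq_zero.1 this with h | h
  exacts [h₀ h, h₁ (by linarith)]

/-- The values of the variables. -/
abbrev Value : Type v := ULift.{v} (Bool × Bool)

/-- A fair coin. -/
noncomputable def coin : Measure Bool := (PMF.uniformOfFintype Bool).toMeasure

instance : IsProbabilityMeasure coin := by unfold coin; infer_instance

/-- The ends of the chain are the two coins, the middle vertex is the pair of them. -/
def coords (ω : Bool × Bool) (i : Vertex.{u}) : Value.{v} :=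
  if i = n0 then ⟨(ω.1, ω.1)⟩ else if i = n2 then ⟨(ω.2, ω.2)⟩ else ⟨ω⟩

theorem measurable_coords : Measurable coords.{u, v} := measurable_of_countable _

/-- The joint distribution of the two coins and their pair. -/
noncomputable def law : ProbabilityMeasure (∀ _ : Vertex.{u}, Value.{v}) :=
  ⟨(coin.prod coin).map coords,
    Measure.isProbabilityMeasure_map measurable_coords.aemeasurable⟩

theorem law_indepFun : IndepFun (fun ω : ∀ _ : Vertex.{u}, Value.{v} => ω n0) (fun ω => ω n2)
    (law.{u, v} : Measure (∀ _ : Vertex.{u}, Value.{v})) := by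
  have hp := indepFun_prod (μ := coin) (ν := coin) (X := fun a => (⟨(a, a)⟩ : Value.{v}))
    (Y := fun a => (⟨(a, a)⟩ : Value.{v})) (measurable_of_countable _) (measurable_of_countable _)
  rw [indepFun_iff_measure_inter_preimage_eq_mul] at hp ⊢
  intro s t hs ht
  have h := hp s t hs ht
  have hms := measurable_pi_apply (X := fun _ : Vertex.{u} => Value.{v}) n0 hs
  have hmt := measurable_pi_apply (X := fun _ : Vertex.{u} => Value.{v}) n2 ht
  simp only [law, ProbabilityMeasure.coe_mk]
  rw [Measure.map_apply measurable_coords (hms.inter hmt),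
    Measure.map_apply measurable_coords hms, Measure.map_apply measurable_coords hmt]
  simpa [Set.preimage_preimage, coords] using h

theorem law_ae {p : (∀ _ : Vertex.{u}, Value.{v}) → Prop} (h : ∀ ω, p (coords ω)) :
    ∀ᵐ ω ∂(law.{u, v} : Measure (∀ _ : Vertex.{u}, Value.{v})), p ω := by
  simp only [law, ProbabilityMeasure.coe_mk]
  rw [ae_map_iff measurable_coords.aemeasurable (Set.to_countable _).measurableSet]
  exact Filter.Eventually.of_forall h

theorem coin_true : coin {true} = 2⁻¹ := by
  rw [coin, PMF.toMeasure_apply_singleton _ _ (measurableSet_singleton _)]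
  simp

theorem law_first : (law.{u, v} : Measure (∀ _ : Vertex.{u}, Value.{v})).real
    {ω | (ω n0).down.1 = true} = 2⁻¹ := by
  have he : coords.{u, v} ⁻¹' {ω | (ω n0).down.1 = true} = {true} ×ˢ Set.univ := by
    ext ω
    simp [coords]
  simp only [law, ProbabilityMeasure.coe_mk, measureReal_def]
  rw [Measure.map_apply measurable_coords (Set.to_countable _).measurableSet, he,
    Measure.prod_prod, coin_true, measure_univ]
  simp

theorem law_second : (law.{u, v} : Measure (∀ _ : Vertex.{u}, Value.{v})).real
    {ω | (ω n2).down.2 = true} = 2⁻¹ := by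
  have he : coords.{u, v} ⁻¹' {ω | (ω n2).down.2 = true} = Set.univ ×ˢ {true} := by
    ext ω
    simp [coords]
  simp only [law, ProbabilityMeasure.coe_mk, measureReal_def]
  rw [Measure.map_apply measurable_coords (Set.to_countable _).measurableSet, he,
    Measure.prod_prod, coin_true, measure_univ]
  simp

theorem law_indepFun_restrict {X Z : Set Vertex.{u}} (hX : X ⊆ {n0}) (hZ : Z ⊆ {n2}) :
    IndepFun (fun (ω : ∀ _ : Vertex.{u}, Value.{v}) (i : X) => ω i) (fun ω (i : Z) => ω i)
      (law.{u, v} : Measure (∀ _ : Vertex.{u}, Value.{v})) := by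
  have h := law_indepFun.{u, v}.comp (φ := fun x (_ : X) => x) (ψ := fun x (_ : Z) => x)
    (by fun_prop) (by fun_prop)
  convert h using 1
  · funext ω i
    rw [show (i : Vertex.{u}) = n0 from hX i.2]
    rfl
  · funext ω i
    rw [show (i : Vertex.{u}) = n2 from hZ i.2]
    rfl

/-- The common event is that the coin at the end vertex shows `true`: the middle vertex reveals it,
the opposite end is independent of it, and its probability is one half. -/
theorem law_neighboursDependent : NeighboursDependent law.{u, v} := by
  constructor
  · intro Z hZ
    refine not_condIndepFun_of_common_event (by fun_prop) (by fun_prop)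
      (law_indepFun_restrict subset_rfl hZ) (s := {x | (x ⟨n0, rfl⟩).down.1 = true})
      (t := {x | (x ⟨n1, rfl⟩).down.1 = true}) (Set.to_countable _).measurableSet
      (Set.to_countable _).measurableSet ?_ ?_ ?_
    · refine Filter.eventuallyEq_set.2 (law_ae fun ω => ?_)
      simp [coords]
    · exact law_first.trans_ne (by norm_num)
    · exact law_first.trans_ne (by norm_num)
  · intro Z hZ h
    refine not_condIndepFun_of_common_event (by fun_prop) (by fun_prop)
      (law_indepFun_restrict hZ subset_rfl).symm (s := {x | (x ⟨n2, rfl⟩).down.2 = true})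
      (t := {x | (x ⟨n1, rfl⟩).down.2 = true}) (Set.to_countable _).measurableSet
      (Set.to_countable _).measurableSet ?_ ?_ ?_ (condIndepVars_symm h)
    · refine Filter.eventuallyEq_set.2 (law_ae fun ω => ?_)
      simp [coords]
    · exact law_second.trans_ne (by norm_num)
    · exact law_second.trans_ne (by norm_num)

/-- Almost surely `n0` is a function of `n1`, and a variable measurable for the conditioning
σ-algebra is conditionally independent of every other. -/
theorem law_condIndepVars_middle : CondIndepVars law.{u, v} {n0} {n2} {n1} := by
  refine condIndepFun_congr_left
    (f := fun ω (_ : ({n0} : Set Vertex.{u})) => (⟨((ω n1).down.1, (ω n1).down.1)⟩ : Value.{v}))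
    (measurable_of_countable _) (by fun_prop) (by fun_prop) ?_
    (condIndepFun_of_measurable_left ?_ (by fun_prop))
  · refine law_ae fun ω => ?_
    funext i
    dsimp only
    rw [show (i : Vertex.{u}) = n0 from i.2]
    simp [coords]
  · refine Measurable.comp
      (g := fun (x : ({n1} : Set Vertex.{u}) → Value.{v}) (_ : ({n0} : Set Vertex.{u})) =>
        (⟨((x ⟨n1, rfl⟩).down.1, (x ⟨n1, rfl⟩).down.1)⟩ : Value.{v}))
      (measurable_of_countable _) (comap_measurable _)

theorem law_condIndepVars_empty : CondIndepVars law.{u, v} {n0} {n2} ∅ := by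
  have hi := law_indepFun_restrict.{u, v} (X := {n0}) (Z := {n2}) subset_rfl subset_rfl
  rw [indepFun_iff_measure_inter_preimage_eq_mul] at hi
  unfold CondIndepVars
  rw [condIndepFun_iff_condExp_inter_preimage_eq_mul (by fun_prop) (by fun_prop)]
  have hbot : MeasurableSpace.comap
      (fun (ω : ∀ _ : Vertex.{u}, Value.{v}) (i : (∅ : Set Vertex.{u})) => ω i)
      MeasurableSpace.pi = ⊥ := by
    have : (fun (ω : ∀ _ : Vertex.{u}, Value.{v}) (i : (∅ : Set Vertex.{u})) => ω i) =
        fun _ => fun i => i.2.elim := by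
      funext ω i
      exact i.2.elim
    rw [this, MeasurableSpace.comap_const]
  intro s t hs ht
  simp only [hbot, condExp_bot]
  refine Filter.Eventually.of_forall fun ω => ?_
  have hms : MeasurableSet ((fun (ω : ∀ _ : Vertex.{u}, Value.{v})
      (i : ({n0} : Set Vertex.{u})) => ω i) ⁻¹' s) := (Set.to_countable _).measurableSet
  have hmt : MeasurableSet ((fun (ω : ∀ _ : Vertex.{u}, Value.{v})
      (i : ({n2} : Set Vertex.{u})) => ω i) ⁻¹' t) := (Set.to_countable _).measurableSet
  simp only [integral_indicator_const _ (hms.inter hmt), integral_indicator_const _ hms,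
    integral_indicator_const _ hmt, smul_eq_mul, mul_one, measureReal_def, hi s t hs ht,
    ENNReal.toReal_mul]

theorem law_markov : Markov chain law.{u, v} := chain_markov law_condIndepVars_middle

theorem law_not_faithful : ¬ Faithful chain law.{u, v} :=
  chain_not_faithful law_condIndepVars_empty

end IntransitiveChain

open SMCM IntransitiveChain in
theorem mainTheorem1 :
    IsConservativeWeakening.{u, v} (fun _ _ _ _ _ G P => VAdjFaithful G P) ∧
    IsConservativeWeakening.{u, v} (fun _ _ _ _ _ G P => VAdjMinimal G P) ∧
    IsConservativeWeakening.{u, v} (fun _ _ _ _ _ G P => NoIMinimal G P) := by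
  refine ⟨⟨?_, fun h => ?_, ?_⟩, ⟨?_, fun h => ?_, ?_⟩, ⟨?_, fun h => ?_, ?_⟩⟩
  · intro V _ S _ _ P G _ hF
    exact vAdjFaithful_of_faithful hF
  · exact law_not_faithful.{u, v} (h _ _ _ _ law_markov law_neighboursDependent.vAdjFaithful)
  · rintro V _ S _ _ P ⟨G₀, hM₀, hF₀⟩ G hM
    exact ⟨vAdjFaithful_of_faithful, faithful_of_vAdjFaithful hM hM₀ hF₀⟩
  · intro V _ S _ _ P G _ hF
    exact vAdjMinimal_of_faithful hF
  · exact law_not_faithful.{u, v} (h _ _ _ _ law_markov law_neighboursDependent.vAdjMinimal)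
  · rintro V _ S _ _ P ⟨G₀, hM₀, hF₀⟩ G hM
    exact ⟨vAdjMinimal_of_faithful, faithful_of_vAdjMinimal hM hM₀ hF₀⟩
  · intro V _ S _ _ P G _ hF
    exact noIMinimal_of_faithful hF
  · exact law_not_faithful.{u, v} (h _ _ _ _ law_markov law_neighboursDependent.noIMinimal)
  · rintro V _ S _ _ P ⟨G₀, hM₀, hF₀⟩ G hM
    exact ⟨noIMinimal_of_faithful, faithful_of_noIMinimal hM hM₀ hF₀⟩
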